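/- Let $1<p<\infty$, let $\Omega\subset\mathbb R^N$ ($N\ge 1$) be a bounded open set, $g>0$ and $f\in L^{p'}(\Omega)$ with $p'=p/(p-1)$. Let $W_0^{1,p}(\Omega)$ be the closure of $C_c^\infty(\Omega)$ in $W^{1,p}(\Omega)$, and write $\|v\|_{W_0^{1,p}}:=\|\nabla v\|_{L^p(\Omega)}$. For $u\in W_0^{1,p}(\Omega)$ and $\gamma>0$ put $$J(u)=\frac1p\int_\Omega|\nabla u|^p\,dx+g\int_\Omega|\nabla u|\,dx-\int_\Omega fu\,dx,\qquad J_\gamma(u)=\frac1p\int_\Omega|\nabla u|^p\,dx+\int_\Omega\psi_\gamma(\nabla u)\,dx-\int_\Omega fu\,dx,$$ where $\psi_\gamma(z)=g|z|-\frac{g^2}{2\gamma}$ if $\gamma|z|\ge g$ and $\psi_\gamma(z)=\frac\gamma2|z|^2$ if $\gamma|z|<g$. **Theorem.** The functional $J$ has a unique minimizer $\bar u\in W_0^{1,p}(\Omega)$, for every $\gamma>0$ the functional $J_\gamma$ has a unique minimizer $u_\gamma\in W_0^{1,p}(\Omega)$, and $u_\gamma\to\bar u$ strongly in $W_0^{1,p}(\Omega)$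 (that is, $u_\gamma\to\bar u$ in $L^p(\Omega)$ and $\nabla u_\gamma\to\nabla\bar u$ in $L^p(\Omega)^N$) as $\gamma\to\infty$. Moreover there is a constant $c_p>0$ depending only on $p$ such that, for all $N,\Omega,g,f$ as above and all $\gamma>0$: * if $p\ge 2$, then $\displaystyle\|\bar u-u_\gamma\|_{W_0^{1,p}}\le\Big(\frac{g^2|\Omega|}{c_p\,\gamma}\Big)^{1/p}$; * if $1<p<2$, then $\displaystyle\|\bar u-u_\gamma\|_{W_0^{1,p}}\le\Big(\frac{g^2|\Omega|}{c_p\,\gamma}\Big)^{1/2}\big(\|\bar u\|_{W_0^{1,p}}+\|u_\gamma\|_{W_0^{1,p}}\big)^{(2-p)/2}$, and consequently there is a constant $C$ independent of $\gamma$ with $\|\bar u-u_\gamma\|_{W_0^{1,p}}\le C\gamma^{-1/2}$. -/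

import Mathlib

open MeasureTheory Filter Topology
open scoped ENNReal ContDiff

noncomputable section

/-- `1 ≤ p` in `[0, ∞]`, so that `L^p` is a Banach space. -/
instance instFactOneLeOfReal {p : ℝ} [hp : Fact (1 < p)] : Fact (1 ≤ ENNReal.ofReal p) :=
  ⟨by simpa using ENNReal.ofReal_le_ofReal hp.out.le⟩

/-- Test functions on `Ω`: smooth, with compact support contained in `Ω`. -/
structure IsTestFunction {N : ℕ} (Ω : Set (EuclideanSpace ℝ (Fin N)))
    (φ : EuclideanSpace ℝ (Fin N) → ℝ) : Prop where
  contDiff : ContDiff ℝ ∞ φ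
  hasCompactSupport : HasCompactSupport φ
  tsupport_subset : tsupport φ ⊆ Ω

/-- The space `L^p(Ω; F)` for a real exponent `p` and Lebesgue measure. -/
abbrev LpOn {N : ℕ} (Ω : Set (EuclideanSpace ℝ (Fin N))) (p : ℝ) (F : Type*)
    [NormedAddCommGroup F] : Type _ :=
  Lp F (ENNReal.ofReal p) (volume.restrict Ω)

/-- The graph `{(φ, ∇φ) : φ ∈ C_c^∞(Ω)}` as a subspace of `L^p(Ω) × L^p(Ω)^N`. -/
def testGraph {N : ℕ} (Ω : Set (EuclideanSpace ℝ (Fin N))) (p : ℝ) :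
    Submodule ℝ (LpOn Ω p ℝ × LpOn Ω p (EuclideanSpace ℝ (Fin N))) where
  carrier := {w | ∃ φ : EuclideanSpace ℝ (Fin N) → ℝ, IsTestFunction Ω φ ∧
    w.1 =ᵐ[volume.restrict Ω] φ ∧ w.2 =ᵐ[volume.restrict Ω] gradient φ}
  zero_mem' := by
    refine ⟨fun _ => 0, ⟨contDiff_const, HasCompactSupport.zero, by simp [tsupport]⟩, ?_, ?_⟩
    · exact Lp.coeFn_zero _ _ _
    · filter_upwards [Lp.coeFn_zero (EuclideanSpace ℝ (Fin N)) (ENNReal.ofReal p)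
        (volume.restrict Ω)] with x hx
      simp only [Prod.snd_zero, hx, gradient, Pi.zero_apply]
      simp
  add_mem' := by
    rintro a b ⟨φ, hφ, ha1, ha2⟩ ⟨χ, hχ, hb1, hb2⟩
    refine ⟨φ + χ, ⟨hφ.contDiff.add hχ.contDiff,
      hφ.hasCompactSupport.add hχ.hasCompactSupport,
      (tsupport_add φ χ).trans (Set.union_subset hφ.tsupport_subset hχ.tsupport_subset)⟩, ?_, ?_⟩
    · exact (Lp.coeFn_add a.1 b.1).trans (ha1.add hb1)
    · filter_upwards [Lp.coeFn_add a.2 b.2, ha2, hb2] with x h1 h2 h3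
      rw [Prod.snd_add, h1, Pi.add_apply, h2, h3]
      simp only [gradient]
      rw [fderiv_add (hφ.contDiff.differentiable (by simp) x)
        (hχ.contDiff.differentiable (by simp) x), map_add]
  smul_mem' := by
    rintro c a ⟨φ, hφ, ha1, ha2⟩
    refine ⟨c • φ, ⟨contDiff_const.smul hφ.contDiff, hφ.hasCompactSupport.smul_left,
      (tsupport_smul_subset_right (fun _ => c) φ).trans hφ.tsupport_subset⟩, ?_, ?_⟩
    · exact (Lp.coeFn_smul c a.1).trans (ha1.const_smul c)
    · filter_upwards [Lp.coeFn_smul c a.2, ha2] with x h1 h2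
      rw [Prod.smul_snd, h1, Pi.smul_apply, h2]
      simp only [gradient]
      rw [fderiv_const_smul (hφ.contDiff.differentiable (by simp) x), map_smul]

/-- The Sobolev space `W_0^{1,p}(Ω)`, the closure of `C_c^∞(Ω)` in the `W^{1,p}` norm.
A function `u` is represented by the pair `(u, ∇u) ∈ L^p(Ω) × L^p(Ω)^N`, and the topology is that
of `L^p(Ω) × L^p(Ω)^N`, which is the one of the `W^{1,p}` norm. The second component is the weak
gradient of the first, see `W01p.hasWeakGradient`. -/
def W01p {N : ℕ} (Ω : Set (EuclideanSpace ℝ (Fin N))) (p : ℝ) [Fact (1 < p)] :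
    Submodule ℝ (LpOn Ω p ℝ × LpOn Ω p (EuclideanSpace ℝ (Fin N))) :=
  (testGraph Ω p).topologicalClosure

namespace W01p

variable {N : ℕ} {Ω : Set (EuclideanSpace ℝ (Fin N))} {p : ℝ} [Fact (1 < p)]

/-- The underlying function `u ∈ L^p(Ω)` of an element of `W_0^{1,p}(Ω)`. -/
def fn (u : W01p Ω p) : LpOn Ω p ℝ := u.1.1

/-- The weak gradient `∇u ∈ L^p(Ω)^N` of an element of `W_0^{1,p}(Ω)`. -/
def grad (u : W01p Ω p) : LpOn Ω p (EuclideanSpace ℝ (Fin N)) := u.1.2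

/-- The norm `‖u‖_{W_0^{1,p}} = ‖∇u‖_{L^p}`. -/
def gradNorm (u : W01p Ω p) : ℝ := ‖grad u‖

end W01p

/-- `G` is the weak gradient of `u` on `Ω`: `∫_Ω u ∂ₑφ = - ∫_Ω (G, e) φ` for all test functions
`φ` and all directions `e`. -/
def HasWeakGradient {N : ℕ} (Ω : Set (EuclideanSpace ℝ (Fin N)))
    (u : EuclideanSpace ℝ (Fin N) → ℝ)
    (G : EuclideanSpace ℝ (Fin N) → EuclideanSpace ℝ (Fin N)) : Prop :=
  ∀ φ, IsTestFunction Ω φ → ∀ e : EuclideanSpace ℝ (Fin N),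
    ∫ x in Ω, u x * fderiv ℝ φ x e = - ∫ x in Ω, inner ℝ (G x) e * φ x

theorem IsTestFunction.fderiv_apply_props {N : ℕ} {Ω : Set (EuclideanSpace ℝ (Fin N))}
    {φ : EuclideanSpace ℝ (Fin N) → ℝ} (h : IsTestFunction Ω φ) (e : EuclideanSpace ℝ (Fin N)) :
    Continuous (fun x => fderiv ℝ φ x e) ∧ HasCompactSupport (fun x => fderiv ℝ φ x e) :=
  ⟨(h.contDiff.continuous_fderiv (by simp)).clm_apply continuous_const,
    h.hasCompactSupport.fderiv_apply (𝕜 := ℝ) e⟩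

/-- The second component of an element of `W_0^{1,p}(Ω)` is the weak gradient of the first. -/
theorem W01p.hasWeakGradient {N : ℕ} {Ω : Set (EuclideanSpace ℝ (Fin N))} {p : ℝ}
    [hp : Fact (1 < p)] (u : W01p Ω p) : HasWeakGradient Ω (W01p.fn u) (W01p.grad u) := by
  intro χ hχ e
  have hconj : (p.conjExponent).HolderConjugate p := (Real.HolderConjugate.conjExponent hp.out).symm
  have : ENNReal.HolderConjugate (ENNReal.ofReal p.conjExponent) (ENNReal.ofReal p) :=
    hconj.ennrealOfReal
  have : Fact (1 ≤ ENNReal.ofReal p.conjExponent) :=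
    ⟨by simpa using ENNReal.ofReal_le_ofReal hconj.lt.le⟩
  obtain ⟨hc, hs⟩ := hχ.fderiv_apply_props e
  have m1 : MemLp (fun x => fderiv ℝ χ x e) (ENNReal.ofReal p.conjExponent)
      (volume.restrict Ω) := hc.memLp_of_hasCompactSupport hs
  have m2 : MemLp (fun x => χ x • e) (ENNReal.ofReal p.conjExponent) (volume.restrict Ω) :=
    (hχ.contDiff.continuous.smul continuous_const).memLp_of_hasCompactSupport
      hχ.hasCompactSupport.smul_right
  set P := (ContinuousLinearMap.mul ℝ ℝ).lpPairing (volume.restrict Ω)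
    (ENNReal.ofReal p.conjExponent) (ENNReal.ofReal p) (m1.toLp _) with hP
  set Q := (innerSL ℝ (E := EuclideanSpace ℝ (Fin N))).lpPairing (volume.restrict Ω)
    (ENNReal.ofReal p.conjExponent) (ENNReal.ofReal p) (m2.toLp _) with hQ
  have eP : ∀ v : LpOn Ω p ℝ, P v = ∫ x in Ω, v x * fderiv ℝ χ x e := by
    intro v
    rw [hP, ContinuousLinearMap.lpPairing_eq_integral]
    refine integral_congr_ae ?_
    filter_upwards [m1.coeFn_toLp] with x hx
    rw [hx, ContinuousLinearMap.mul_apply', mul_comm]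
  have eQ : ∀ v : LpOn Ω p (EuclideanSpace ℝ (Fin N)),
      Q v = ∫ x in Ω, inner ℝ (v x) e * χ x := by
    intro v
    rw [hQ, ContinuousLinearMap.lpPairing_eq_integral]
    refine integral_congr_ae ?_
    filter_upwards [m2.coeFn_toLp] with x hx
    rw [hx, innerSL_apply_apply, inner_smul_left, real_inner_comm, mul_comm]
    simp
  have hcl : IsClosed {w : LpOn Ω p ℝ × LpOn Ω p (EuclideanSpace ℝ (Fin N)) |
      P w.1 = - Q w.2} :=
    isClosed_eq (P.continuous.comp continuous_fst) (Q.continuous.comp continuous_snd).neg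
  have hsub : (testGraph Ω p : Set (LpOn Ω p ℝ × LpOn Ω p (EuclideanSpace ℝ (Fin N)))) ⊆
      {w | P w.1 = - Q w.2} := by
    rintro w ⟨φ, hφ, h1, h2⟩
    obtain ⟨hc', hs'⟩ := hφ.fderiv_apply_props e
    have hχc := hχ.contDiff.continuous
    have hφc := hφ.contDiff.continuous
    have r1 : ∫ x in Ω, w.1 x * fderiv ℝ χ x e = ∫ x, φ x * fderiv ℝ χ x e := by
      rw [integral_congr_ae (g := fun x => φ x * fderiv ℝ χ x e)
        (h1.mono fun x hx => by simp only [hx])]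
      refine setIntegral_eq_integral_of_forall_compl_eq_zero fun x hx => ?_
      rw [image_eq_zero_of_notMem_tsupport fun h => hx (hφ.tsupport_subset h), zero_mul]
    have r2 : ∫ x in Ω, inner ℝ (w.2 x) e * χ x = ∫ x, fderiv ℝ φ x e * χ x := by
      rw [integral_congr_ae (g := fun x => fderiv ℝ φ x e * χ x)
        (h2.mono fun x hx => by simp only [hx, gradient, InnerProductSpace.toDual_symm_apply])]
      refine setIntegral_eq_integral_of_forall_compl_eq_zero fun x hx => ?_
      rw [image_eq_zero_of_notMem_tsupport (f := χ) fun h => hx (hχ.tsupport_subset h), mul_zero]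
    change P w.1 = - Q w.2
    rw [eP, eQ, r1, r2]
    exact integral_mul_fderiv_eq_neg_fderiv_mul_of_integrable
      ((hc'.mul hχc).integrable_of_hasCompactSupport hs'.mul_right)
      ((hφc.mul hc).integrable_of_hasCompactSupport hs.mul_left)
      ((hφc.mul hχc).integrable_of_hasCompactSupport hφ.hasCompactSupport.mul_right)
      (fun x _ => hφ.contDiff.differentiable (by simp) x)
      (fun x _ => hχ.contDiff.differentiable (by simp) x)
  have := closure_minimal hsub hcl u.2
  change P u.1.1 = - Q u.1.2 at this
  rw [eP, eQ] at this
  exact this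

/-- The Huber function `ψ_γ` with parameter `g`. -/
def huber {N : ℕ} (g γ : ℝ) (z : EuclideanSpace ℝ (Fin N)) : ℝ :=
  if g ≤ γ * ‖z‖ then g * ‖z‖ - g ^ 2 / (2 * γ) else γ / 2 * ‖z‖ ^ 2

/-- `J(u) = (1/p) ∫_Ω |∇u|^p + g ∫_Ω |∇u| - ∫_Ω f u`. -/
def energyJ {N : ℕ} {Ω : Set (EuclideanSpace ℝ (Fin N))} {p : ℝ} [Fact (1 < p)]
    (g : ℝ) (f : EuclideanSpace ℝ (Fin N) → ℝ) (u : W01p Ω p) : ℝ :=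
  1 / p * (∫ x in Ω, ‖W01p.grad u x‖ ^ p) + g * (∫ x in Ω, ‖W01p.grad u x‖) - ∫ x in Ω, f x * W01p.fn u x

/-- `J_γ(u) = (1/p) ∫_Ω |∇u|^p + ∫_Ω ψ_γ(∇u) - ∫_Ω f u`. -/
def energyJγ {N : ℕ} {Ω : Set (EuclideanSpace ℝ (Fin N))} {p : ℝ} [Fact (1 < p)]
    (g : ℝ) (f : EuclideanSpace ℝ (Fin N) → ℝ) (γ : ℝ) (u : W01p Ω p) : ℝ :=
  1 / p * (∫ x in Ω, ‖W01p.grad u x‖ ^ p) + (∫ x in Ω, huber g γ (W01p.grad u x)) - ∫ x in Ω, f x * W01p.fn u x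

/-- `u` is a global minimizer of `F`. -/
def IsMinimizer {X : Type*} (F : X → ℝ) (u : X) : Prop := ∀ v, F u ≤ F v

end

/-! Everything rests on the midpoint (Jensen) gap `(E u + E v) / 2 - E ((u + v) / 2)`. Both
functionals are the p-energy plus a convex friction term minus a linear term. The linear term has
zero gap and the friction gap is nonnegative, so `p` times the gap of either functional dominates
that of `‖∇u‖ ^ p`, and uniform convexity of `L^p` turns the latter into a bound on `‖∇u - ∇v‖`
(`norm_gap_le_midpointGap`). For `p ≥ 2` this is Clarkson's inequality; for `p < 2` it is quadratic,
with weight `(‖∇u‖ + ‖∇v‖) ^ (2 - p)`.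

Near-minimizers have small gap, since the energy at their midpoint is at least the infimum. With
coercivity and Poincaré's inequality, minimizing sequences are therefore Cauchy, which gives
existence without weak compactness; uniqueness is the case of zero gap.

For the rate, `0 ≤ g|z| - ψ_γ(z) ≤ g² / (2γ)` pointwise, so `J_γ ≤ J ≤ J_γ + g²|Ω| / (2γ)`. Adding
the gaps of `J` and `J_γ` at their two minimizers leaves at most `g²|Ω| / (4γ)`
(`midpointGap_add_le`). Strong convergence follows from the rate. -/

/-! ### Pointwise uniform convexity of the p-th power of the norm -/

/-- The parallelogram law handles the squares; `t ↦ t ^ (p / 2)` is superadditive and convex because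
`p / 2 ≥ 1`. -/
theorem rpow_norm_midpoint_add_le {F : Type*} [NormedAddCommGroup F] [InnerProductSpace ℝ F]
    {p : ℝ} (hp : 2 ≤ p) (a b : F) :
    ‖(1 / 2 : ℝ) • (a + b)‖ ^ p + (1 / 2 : ℝ) ^ p * ‖a - b‖ ^ p ≤ (‖a‖ ^ p + ‖b‖ ^ p) / 2 := by
  have hp2 : 1 ≤ p / 2 := by linarith
  have sq (z : F) : (‖z‖ ^ 2) ^ (p / 2) = ‖z‖ ^ p := by
    rw [← Real.rpow_natCast, ← Real.rpow_mul (norm_nonneg z)]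
    congr 1; push_cast; ring
  have hh : (1 / 2 : ℝ) ^ p * ‖a - b‖ ^ p = ‖(1 / 2 : ℝ) • (a - b)‖ ^ p := by
    rw [norm_smul, Real.mul_rpow (by positivity) (by positivity)]
    norm_num
  have par : ‖(1 / 2 : ℝ) • (a + b)‖ ^ 2 + ‖(1 / 2 : ℝ) • (a - b)‖ ^ 2
      = (1 / 2) * ‖a‖ ^ 2 + (1 / 2) * ‖b‖ ^ 2 := by
    have := parallelogram_law_with_norm ℝ a b
    rw [norm_smul, norm_smul]
    norm_num
    nlinarith
  rw [hh, ← sq, ← sq, ← sq, ← sq]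
  refine (Real.add_rpow_le_rpow_add (by positivity) (by positivity) hp2).trans ?_
  rw [par]
  have := (convexOn_rpow hp2).2 (Set.mem_Ici.2 (by positivity : 0 ≤ ‖a‖ ^ 2))
    (Set.mem_Ici.2 (by positivity : 0 ≤ ‖b‖ ^ 2)) (by norm_num : (0 : ℝ) ≤ 1 / 2)
    (by norm_num : (0 : ℝ) ≤ 1 / 2) (by norm_num)
  simp only [smul_eq_mul] at this
  linarith

theorem hasDerivAt_rpow_sub_sq {p c r : ℝ} (hr : 0 < r) :
    HasDerivAt (fun r : ℝ => r ^ p - c * r ^ 2) (p * r ^ (p - 1) - c * (2 * r)) r := by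
  have h1 := Real.hasDerivAt_rpow_const (x := r) (p := p) (Or.inl hr.ne')
  have h2 := (hasDerivAt_pow 2 r).const_mul c
  exact (h1.sub h2).congr_deriv (by norm_num)

/-- For `p < 2` the second derivative `p (p - 1) r ^ (p - 2)` is smallest at `r = R`; the subtracted
quadratic has exactly that second derivative. Monotonicity is what allows composition with the norm.
-/
theorem convexOn_monotoneOn_rpow_sub_sq {p R : ℝ} (h1 : 1 < p) (h2 : p < 2) (hR : 0 < R) :
    ConvexOn ℝ (Set.Icc 0 R) (fun r : ℝ => r ^ p - p * (p - 1) / 2 * R ^ (p - 2) * r ^ 2) ∧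
    MonotoneOn (fun r : ℝ => r ^ p - p * (p - 1) / 2 * R ^ (p - 2) * r ^ 2) (Set.Icc 0 R) := by
  set c := p * (p - 1) / 2 * R ^ (p - 2) with hc
  have hcont : ContinuousOn (fun r : ℝ => r ^ p - c * r ^ 2) (Set.Icc 0 R) := by
    refine Continuous.continuousOn ?_
    have := Real.continuous_rpow_const (q := p) (by linarith)
    fun_prop
  have hd (r : ℝ) (hr : r ∈ interior (Set.Icc 0 R)) :
      HasDerivAt (fun r : ℝ => r ^ p - c * r ^ 2) (p * r ^ (p - 1) - c * (2 * r)) r := by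
    rw [interior_Icc] at hr
    exact hasDerivAt_rpow_sub_sq hr.1
  have hle {r : ℝ} (hr : r ∈ interior (Set.Icc 0 R)) : R ^ (p - 2) ≤ r ^ (p - 2) := by
    rw [interior_Icc] at hr
    exact Real.rpow_le_rpow_of_nonpos hr.1 hr.2.le (by linarith)
  constructor
  · refine MonotoneOn.convexOn_of_deriv (convex_Icc 0 R) hcont
      (fun r hr => (hd r hr).differentiableAt.differentiableWithinAt) ?_
    have heq : Set.EqOn (fun r : ℝ => p * r ^ (p - 1) - c * (2 * r))
        (deriv fun r : ℝ => r ^ p - c * r ^ 2) (interior (Set.Icc 0 R)) :=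
      fun r hr => (hd r hr).deriv.symm
    refine MonotoneOn.congr ?_ heq
    have hd2 (r : ℝ) (hr : r ∈ interior (Set.Icc 0 R)) :
        HasDerivAt (fun r : ℝ => p * r ^ (p - 1) - c * (2 * r))
          (p * ((p - 1) * r ^ (p - 2)) - c * 2) r := by
      rw [interior_Icc] at hr
      have h1 := (Real.hasDerivAt_rpow_const (x := r) (p := p - 1) (Or.inl hr.1.ne')).const_mul p
      have h2 := ((hasDerivAt_id r).const_mul 2).const_mul c
      exact (h1.sub h2).congr_deriv (by rw [show p - 1 - 1 = p - 2 by ring]; ring)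
    refine monotoneOn_of_deriv_nonneg (convex_Icc 0 R).interior
      (fun r hr => (hd2 r hr).continuousAt.continuousWithinAt)
      (fun r hr => (hd2 r (interior_subset hr)).differentiableAt.differentiableWithinAt)
      (fun r hr => ?_)
    rw [(hd2 r (interior_subset hr)).deriv, hc]
    have := mul_le_mul_of_nonneg_left (hle (interior_subset hr))
      (mul_nonneg (by linarith : 0 ≤ p) (by linarith : 0 ≤ p - 1))
    linarith
  · refine monotoneOn_of_deriv_nonneg (convex_Icc 0 R) hcont
      (fun r hr => (hd r hr).differentiableAt.differentiableWithinAt) (fun r hr => ?_)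
    rw [(hd r hr).deriv, hc]
    have h := hle hr
    rw [interior_Icc] at hr
    have e : r ^ (p - 1) = r ^ (p - 2) * r := by
      rw [← Real.rpow_add_one hr.1.ne']; congr 1; ring
    rw [e]
    have hRp : 0 < R ^ (p - 2) := Real.rpow_pos_of_pos hR _
    have h3 : (p - 1) * R ^ (p - 2) ≤ r ^ (p - 2) := by nlinarith
    have := mul_le_mul_of_nonneg_left h3 (mul_nonneg (by linarith : 0 ≤ p) hr.1.le)
    linarith

theorem norm_half_smul_add_le {F : Type*} [NormedAddCommGroup F] [NormedSpace ℝ F] (a b : F) :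
    ‖(1 / 2 : ℝ) • (a + b)‖ ≤ (‖a‖ + ‖b‖) / 2 := by
  rw [norm_smul]
  have := norm_add_le a b
  norm_num
  linarith

/-- With `R = ‖a‖ + ‖b‖` and `c = p (p - 1) / 2 * R ^ (p - 2)`, the function `‖·‖ ^ p - c ‖·‖ ^ 2`
has nonnegative midpoint gap, and by the parallelogram law the gap of `c ‖·‖ ^ 2` is exactly `c ‖a -
b‖ ^ 2 / 4`. -/
theorem sq_norm_sub_le_rpow_gap {F : Type*} [NormedAddCommGroup F] [InnerProductSpace ℝ F]
    {p : ℝ} (h1 : 1 < p) (h2 : p < 2) (a b : F) :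
    ‖a - b‖ ^ 2 ≤ 8 / (p * (p - 1)) *
      ((‖a‖ ^ p + ‖b‖ ^ p) / 2 - ‖(1 / 2 : ℝ) • (a + b)‖ ^ p) * (‖a‖ + ‖b‖) ^ (2 - p) := by
  -- For `R = 0` the identity `R ^ (p - 2) * R ^ (2 - p) = 1` used below fails.
  rcases (by positivity : 0 ≤ ‖a‖ + ‖b‖).eq_or_lt with h0 | hR
  · have ha : a = 0 := norm_eq_zero.1 (by linarith [norm_nonneg a, norm_nonneg b])
    have hb : b = 0 := norm_eq_zero.1 (by linarith [norm_nonneg a, norm_nonneg b])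
    subst ha hb
    simp [Real.zero_rpow (by linarith : p ≠ 0)]
  set R := ‖a‖ + ‖b‖ with hRdef
  obtain ⟨hcv, hmono⟩ := convexOn_monotoneOn_rpow_sub_sq h1 h2 hR
  have ha : ‖a‖ ∈ Set.Icc 0 R := ⟨norm_nonneg a, by linarith [norm_nonneg b]⟩
  have hb : ‖b‖ ∈ Set.Icc 0 R := ⟨norm_nonneg b, by linarith [norm_nonneg a]⟩
  have hm := norm_half_smul_add_le a b
  have hmid : (‖a‖ + ‖b‖) / 2 ∈ Set.Icc 0 R := ⟨by positivity, by linarith⟩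
  have k1 := hmono ⟨norm_nonneg ((1 / 2 : ℝ) • (a + b)), hm.trans hmid.2⟩ hmid hm
  have k2 := hcv.2 ha hb (by norm_num : (0 : ℝ) ≤ 1 / 2)
    (by norm_num : (0 : ℝ) ≤ 1 / 2) (by norm_num)
  simp only [smul_eq_mul] at k1 k2
  rw [show 1 / 2 * ‖a‖ + 1 / 2 * ‖b‖ = (‖a‖ + ‖b‖) / 2 by ring] at k2
  have par : ‖(1 / 2 : ℝ) • (a + b)‖ ^ 2 + (1 / 4) * ‖a - b‖ ^ 2
      = (1 / 2) * ‖a‖ ^ 2 + (1 / 2) * ‖b‖ ^ 2 := by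
    have := parallelogram_law_with_norm ℝ a b
    rw [norm_smul]
    norm_num
    nlinarith
  have hp1 : p - 1 ≠ 0 := by linarith
  have hpp : 0 < p * (p - 1) := mul_pos (by linarith) (by linarith)
  have e : R ^ (p - 2) * R ^ (2 - p) = 1 := by
    rw [← Real.rpow_add hR]; simp
  set X := (‖a‖ ^ p + ‖b‖ ^ p) / 2 - ‖(1 / 2 : ℝ) • (a + b)‖ ^ p with hX
  have k3 : p * (p - 1) / 8 * R ^ (p - 2) * ‖a - b‖ ^ 2 ≤ X := by
    have e2 : p * (p - 1) / 8 * R ^ (p - 2) * ‖a - b‖ ^ 2 = p * (p - 1) / 2 * R ^ (p - 2) *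
      ((1 / 2) * ‖a‖ ^ 2 + (1 / 2) * ‖b‖ ^ 2 - ‖(1 / 2 : ℝ) • (a + b)‖ ^ 2) := by
      rw [← par]; ring
    rw [e2, hX]
    linarith
  have hR2 : 0 < R ^ (2 - p) := Real.rpow_pos_of_pos hR _
  calc ‖a - b‖ ^ 2 = 8 / (p * (p - 1)) * (p * (p - 1) / 8 * R ^ (p - 2) * ‖a - b‖ ^ 2)
        * R ^ (2 - p) := by
        have : 8 / (p * (p - 1)) * (p * (p - 1) / 8 * R ^ (p - 2) * ‖a - b‖ ^ 2)
          * R ^ (2 - p) = (8 / (p * (p - 1)) * (p * (p - 1) / 8)) * (R ^ (p - 2) * R ^ (2 - p)) *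
            ‖a - b‖ ^ 2 := by ring
        rw [this, e]
        field_simp
    _ ≤ _ := by gcongr

/-! ### Hölder's inequality for powers of integrable functions -/

theorem memLp_rpow_of_integrable {α : Type*} [MeasurableSpace α] {μ : Measure α} {W : α → ℝ}
    {η : ℝ} (hη : 0 < η) (hW : Integrable W μ) (hW0 : 0 ≤ W) :
    MemLp (fun x => W x ^ η) (ENNReal.ofReal η⁻¹) μ := by
  have := (memLp_one_iff_integrable.2 hW).norm_rpow_div (ENNReal.ofReal η)
  rw [one_div, ← ENNReal.ofReal_inv_of_pos hη] at this
  refine this.congr_norm ?_ ?_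
  · exact (hW.aemeasurable.pow_const η).aestronglyMeasurable
  · refine ae_of_all _ fun x => ?_
    rw [ENNReal.toReal_ofReal hη.le, Real.norm_of_nonneg (hW0 x)]

theorem integral_rpow_mul_rpow_le {α : Type*} [MeasurableSpace α] {μ : Measure α} {U V : α → ℝ}
    {θ : ℝ} (h0 : 0 < θ) (h1 : θ < 1) (hU : Integrable U μ) (hV : Integrable V μ)
    (hU0 : 0 ≤ U) (hV0 : 0 ≤ V) :
    ∫ x, U x ^ θ * V x ^ (1 - θ) ∂μ ≤ (∫ x, U x ∂μ) ^ θ * (∫ x, V x ∂μ) ^ (1 - θ) := by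
  have hpq : (θ⁻¹).HolderConjugate (1 - θ)⁻¹ := by
    rw [Real.holderConjugate_iff]
    exact ⟨(one_lt_inv₀ h0).2 h1, by simp⟩
  have := integral_mul_le_Lp_mul_Lq_of_nonneg (μ := μ) hpq
    (ae_of_all _ fun x => Real.rpow_nonneg (hU0 x) θ)
    (ae_of_all _ fun x => Real.rpow_nonneg (hV0 x) (1 - θ))
    (memLp_rpow_of_integrable h0 hU hU0)
    (memLp_rpow_of_integrable (by linarith) hV hV0)
  have e {W : α → ℝ} {η : ℝ} (hη : 0 < η) (hW0 : 0 ≤ W) (x : α) : (W x ^ η) ^ η⁻¹ = W x := by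
    rw [← Real.rpow_mul (hW0 x), mul_inv_cancel₀ hη.ne', Real.rpow_one]
  simpa only [e h0 hU0, e (sub_pos.2 h1) hV0, one_div, inv_inv] using this

/-! ### The direct method -/

/-- A complete-space form of the direct method: if pairs of almost minimizers are close, a
continuous function that is bounded below attains its infimum. -/
theorem exists_isMinimizer_of_close {X : Type*} [MetricSpace X] [CompleteSpace X] [Nonempty X]
    {F : X → ℝ} (hF : Continuous F) (hbdd : BddBelow (Set.range F))
    (hclose : ∀ ε > 0, ∃ δ > 0, ∀ u v, F u ≤ sInf (Set.range F) + δ →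
      F v ≤ sInf (Set.range F) + δ → dist u v ≤ ε) :
    ∃ u, IsMinimizer F u := by
  set m := sInf (Set.range F) with hm
  obtain ⟨s, hs, hslim, hsmem⟩ :=
    exists_seq_tendsto_sInf (Set.range_nonempty F) hbdd
  choose w hw using hsmem
  have hwlim : Tendsto (fun n => F (w n)) atTop (𝓝 m) := by simpa only [hw] using hslim
  have hcau : CauchySeq w := by
    rw [Metric.cauchySeq_iff]
    intro ε hε
    obtain ⟨δ, hδ, h⟩ := hclose (ε / 2) (half_pos hε)
    obtain ⟨n0, hn0⟩ := (hwlim.eventually (gt_mem_nhds (lt_add_of_pos_right m hδ))).exists_forall_of_atTop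
    exact ⟨n0, fun i hi j hj =>
      (h _ _ (hn0 i hi).le (hn0 j hj).le).trans_lt (half_lt_self hε)⟩
  obtain ⟨u, hu⟩ := cauchySeq_tendsto_of_complete hcau
  have : F u = m := tendsto_nhds_unique ((hF.tendsto u).comp hu) hwlim
  exact ⟨u, fun v => this ▸ csInf_le hbdd ⟨v, rfl⟩⟩

/-! ### Poincaré's inequality -/

theorem LpOn.norm_rpow_eq_integral {N : ℕ} {Ω : Set (EuclideanSpace ℝ (Fin N))} {p : ℝ}
    (hp : 0 < p) {F : Type*} [NormedAddCommGroup F] (v : LpOn Ω p F) :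
    ‖v‖ ^ p = ∫ x in Ω, ‖v x‖ ^ p := by
  rw [Lp.norm_def, (Lp.memLp v).eLpNorm_eq_integral_rpow_norm (by simpa using hp)
    ENNReal.ofReal_ne_top, ENNReal.toReal_ofReal hp.le, ENNReal.toReal_ofReal (by positivity),
    ← Real.rpow_mul (by positivity), inv_mul_cancel₀ hp.ne', Real.rpow_one]

/-- The function `x ↦ ⟨e, x⟩` has derivative one along the unit vector `e`, so integration by parts
gives `∫ |φ| ^ p = -∫ ∂ₑ(|φ| ^ p) ⟨e, x⟩`. On `Ω` the last factor is at most `R`; Hölder's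
inequality then produces a power of `∫ |φ| ^ p` that cancels. -/
theorem IsTestFunction.integral_rpow_le {N : ℕ} (hN : 1 ≤ N)
    {Ω : Set (EuclideanSpace ℝ (Fin N))} {p R : ℝ} (hp : 1 < p) (hR : ∀ x ∈ Ω, ‖x‖ ≤ R)
    (hR0 : 0 ≤ R) {φ : EuclideanSpace ℝ (Fin N) → ℝ} (hφ : IsTestFunction Ω φ) :
    (∫ x, ‖φ x‖ ^ p) ^ (1 / p) ≤ p * R * (∫ x, ‖fderiv ℝ φ x‖ ^ p) ^ (1 / p) := by
  have hp0 : 0 < p := by linarith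
  set e : EuclideanSpace ℝ (Fin N) := EuclideanSpace.single ⟨0, hN⟩ 1 with he
  have hen : ‖e‖ = 1 := by simp [he]
  have hdiff : Differentiable ℝ φ := hφ.contDiff.differentiable (by simp)
  have hFc : ContDiff ℝ 1 (fun x => ‖φ x‖ ^ p) :=
    (hφ.contDiff.of_le (by simp)).norm_rpow hp
  have hFs : HasCompactSupport (fun x => ‖φ x‖ ^ p) :=
    hφ.hasCompactSupport.comp_left (g := fun t : ℝ => ‖t‖ ^ p) (by simp [hp0.ne'])
  have hdF : Continuous (fun x => fderiv ℝ (fun x => ‖φ x‖ ^ p) x e) :=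
    (hFc.continuous_fderiv (by simp)).clm_apply continuous_const
  have hdFs : HasCompactSupport (fun x => fderiv ℝ (fun x => ‖φ x‖ ^ p) x e) :=
    hFs.fderiv_apply (𝕜 := ℝ) e
  have hdg (x : EuclideanSpace ℝ (Fin N)) : fderiv ℝ (fun x => inner ℝ e x) x e = 1 := by
    have : fderiv ℝ (fun x => inner ℝ e x) x = innerSL ℝ e := (innerSL ℝ e).fderiv
    rw [this, innerSL_apply_apply, real_inner_self_eq_norm_sq, hen, one_pow]
  have hgc : Continuous (fun x => inner ℝ e x) := (innerSL ℝ e).continuous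
  have ibp := integral_mul_fderiv_eq_neg_fderiv_mul_of_integrable (μ := volume) (v := e)
    (f := fun x => ‖φ x‖ ^ p) (g := fun x => inner ℝ e x)
    ((hdF.mul hgc).integrable_of_hasCompactSupport hdFs.mul_right)
    (by simpa only [hdg, mul_one] using hFc.continuous.integrable_of_hasCompactSupport hFs)
    ((hFc.continuous.mul hgc).integrable_of_hasCompactSupport hFs.mul_right)
    (fun x _ => hFc.differentiable (by simp) x)
    (fun x _ => (innerSL ℝ e).differentiableAt)
  simp only [hdg, mul_one] at ibp
  have hDc : Continuous (fun x => ‖fderiv ℝ φ x‖) := (hφ.contDiff.continuous_fderiv (by simp)).norm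
  have hDs : HasCompactSupport (fun x => ‖fderiv ℝ φ x‖) :=
    (hφ.hasCompactSupport.fderiv (𝕜 := ℝ)).norm
  have hGc : Continuous (fun x => ‖φ x‖ ^ (p - 1)) :=
    hφ.contDiff.continuous.norm.rpow_const fun x => Or.inr (by linarith)
  have hGs : HasCompactSupport (fun x => ‖φ x‖ ^ (p - 1)) :=
    hφ.hasCompactSupport.comp_left (g := fun t : ℝ => ‖t‖ ^ (p - 1))
      (by simp [(sub_pos.2 hp).ne'])
  have hbound (x : EuclideanSpace ℝ (Fin N)) :
      -(fderiv ℝ (fun x => ‖φ x‖ ^ p) x e * inner ℝ e x) ≤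
        p * R * (‖φ x‖ ^ (p - 1) * ‖fderiv ℝ φ x‖) := by
    have h1 : ‖fderiv ℝ (fun x => ‖φ x‖ ^ p) x e‖ ≤
        p * ‖φ x‖ ^ (p - 1) * ‖fderiv ℝ φ x‖ := by
      refine ((fderiv ℝ (fun x => ‖φ x‖ ^ p) x).le_opNorm e).trans ?_
      rw [hen, mul_one]
      exact norm_fderiv_norm_rpow_le hdiff hp
    have h2 : ‖(inner ℝ e x : ℝ)‖ ≤ ‖x‖ := by simpa [hen] using norm_inner_le_norm (𝕜 := ℝ) e x
    refine (neg_le_abs _).trans ?_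
    rw [← Real.norm_eq_abs, norm_mul]
    by_cases hx : x ∈ Ω
    · calc _ ≤ (p * ‖φ x‖ ^ (p - 1) * ‖fderiv ℝ φ x‖) * R :=
            mul_le_mul h1 (h2.trans (hR x hx)) (norm_nonneg _) (by positivity)
        _ = _ := by ring
    -- Off `Ω` the factor `‖x‖` is not controlled, but both sides vanish there.
    · have h0 : φ x = 0 := image_eq_zero_of_notMem_tsupport fun h => hx (hφ.tsupport_subset h)
      have hp1 : p - 1 ≠ 0 := by linarith
      rw [h0, norm_zero, Real.zero_rpow hp1, mul_zero, zero_mul] at h1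
      rw [h0, norm_zero, Real.zero_rpow hp1, zero_mul, mul_zero,
        norm_le_zero_iff.1 h1, norm_zero, zero_mul]
  set q := p.conjExponent with hq
  have hpq : q.HolderConjugate p := (Real.HolderConjugate.conjExponent hp).symm
  have hG : Integrable (fun x => ‖φ x‖ ^ (p - 1) * ‖fderiv ℝ φ x‖) :=
    (hGc.mul hDc).integrable_of_hasCompactSupport hGs.mul_right
  have holder := integral_mul_le_Lp_mul_Lq_of_nonneg (μ := volume) hpq
    (f := fun x => ‖φ x‖ ^ (p - 1)) (g := fun x => ‖fderiv ℝ φ x‖)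
    (ae_of_all _ fun x => by positivity) (ae_of_all _ fun x => by positivity)
    (hGc.memLp_of_hasCompactSupport hGs) (hDc.memLp_of_hasCompactSupport hDs)
  have hpow (x : EuclideanSpace ℝ (Fin N)) : (‖φ x‖ ^ (p - 1)) ^ q = ‖φ x‖ ^ p := by
    rw [← Real.rpow_mul (norm_nonneg _)]
    congr 1
    exact hpq.symm.sub_one_mul_conj
  simp only [hpow] at holder
  set A := ∫ x, ‖φ x‖ ^ p with hA
  set B := ∫ x, ‖fderiv ℝ φ x‖ ^ p with hB
  have hA0 : 0 ≤ A := integral_nonneg fun x => by positivity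
  have hB0 : 0 ≤ B := integral_nonneg fun x => by positivity
  have hAB : A ≤ p * R * (A ^ (1 / q) * B ^ (1 / p)) := by
    calc A = ∫ x, -(fderiv ℝ (fun x => ‖φ x‖ ^ p) x e * inner ℝ e x) := by
          rw [integral_neg]; exact ibp
      _ ≤ ∫ x, p * R * (‖φ x‖ ^ (p - 1) * ‖fderiv ℝ φ x‖) :=
          integral_mono ((hdF.mul hgc).integrable_of_hasCompactSupport hdFs.mul_right).neg
            (hG.const_mul _) hbound
      _ = p * R * ∫ x, (‖φ x‖ ^ (p - 1) * ‖fderiv ℝ φ x‖) := integral_const_mul _ _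
      _ ≤ _ := by gcongr
  rcases hA0.eq_or_lt with h0 | hpos
  · rw [← h0, Real.zero_rpow (by positivity)]; positivity
  · have hAq : 0 < A ^ (1 / q) := Real.rpow_pos_of_pos hpos _
    have e1 : A = A ^ (1 / q) * A ^ (1 / p) := by
      rw [← Real.rpow_add hpos, one_div, one_div, hpq.inv_add_inv_eq_one, Real.rpow_one]
    refine le_of_mul_le_mul_left ?_ hAq
    rw [← e1]
    linarith

/-- The Poincaré inequality. -/
theorem W01p.exists_norm_fn_le {N : ℕ} (hN : 1 ≤ N) {Ω : Set (EuclideanSpace ℝ (Fin N))}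
    (hΩ : Bornology.IsBounded Ω) (p : ℝ) [hp : Fact (1 < p)] :
    ∃ K, 0 ≤ K ∧ ∀ u : W01p Ω p, ‖W01p.fn u‖ ≤ K * W01p.gradNorm u := by
  have hp0 : 0 < p := by linarith [hp.out]
  obtain ⟨R, hR0, hR⟩ := hΩ.exists_pos_norm_le
  refine ⟨p * R, by positivity, fun u => ?_⟩
  have hcl : IsClosed {w : LpOn Ω p ℝ × LpOn Ω p (EuclideanSpace ℝ (Fin N)) |
      ‖w.1‖ ≤ p * R * ‖w.2‖} := isClosed_le (by fun_prop) (by fun_prop)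
  -- The inequality is a closed condition on pairs, so it passes from test functions to their
  -- closure.
  suffices hsub : (testGraph Ω p : Set (LpOn Ω p ℝ × LpOn Ω p (EuclideanSpace ℝ (Fin N)))) ⊆
      {w | ‖w.1‖ ≤ p * R * ‖w.2‖} from closure_minimal hsub hcl u.2
  rintro w ⟨φ, hφ, h1, h2⟩
  have key := hφ.integral_rpow_le hN hp.out hR hR0.le
  have e1 : ‖w.1‖ ^ p = ∫ x, ‖φ x‖ ^ p := by
    rw [LpOn.norm_rpow_eq_integral hp0, integral_congr_ae (g := fun x => ‖φ x‖ ^ p)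
      (h1.mono fun x hx => by simp only [hx])]
    refine setIntegral_eq_integral_of_forall_compl_eq_zero fun x hx => ?_
    rw [image_eq_zero_of_notMem_tsupport fun h => hx (hφ.tsupport_subset h), norm_zero,
      Real.zero_rpow hp0.ne']
  have e2 : ‖w.2‖ ^ p = ∫ x, ‖fderiv ℝ φ x‖ ^ p := by
    rw [LpOn.norm_rpow_eq_integral hp0, integral_congr_ae (g := fun x => ‖fderiv ℝ φ x‖ ^ p)
      (h2.mono fun x hx => by simp only [hx, gradient, LinearIsometryEquiv.norm_map])]
    refine setIntegral_eq_integral_of_forall_compl_eq_zero fun x hx => ?_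
    rw [fderiv_of_notMem_tsupport ℝ fun h => hx (hφ.tsupport_subset h), norm_zero,
      Real.zero_rpow hp0.ne']
  rw [← e1, ← e2, ← Real.rpow_mul (norm_nonneg _), ← Real.rpow_mul (norm_nonneg _),
    mul_one_div_cancel hp0.ne', Real.rpow_one, Real.rpow_one] at key
  exact key

/-! ### Uniform convexity of `L^p` through midpoint gaps -/

section LpConvexity

variable {N : ℕ} {Ω : Set (EuclideanSpace ℝ (Fin N))} {p : ℝ}
  {F : Type*} [NormedAddCommGroup F]

theorem LpOn.integrable_norm_rpow (hp : 0 < p) (G : LpOn Ω p F) :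
    Integrable (fun x => ‖G x‖ ^ p) (volume.restrict Ω) := by
  have := (Lp.memLp G).integrable_norm_rpow (by simpa using hp) ENNReal.ofReal_ne_top
  rwa [ENNReal.toReal_ofReal hp.le] at this

theorem LpOn.coeFn_midpoint [NormedSpace ℝ F] (G H : LpOn Ω p F) :
    ((1 / 2 : ℝ) • (G + H) : LpOn Ω p F) =ᵐ[volume.restrict Ω]
      fun x => (1 / 2 : ℝ) • (G x + H x) := by
  filter_upwards [Lp.coeFn_smul (1 / 2 : ℝ) (G + H), Lp.coeFn_add G H] with x h1 h2
  rw [h1, Pi.smul_apply, h2, Pi.add_apply]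

variable [Fact (1 < p)]

theorem LpOn.norm_sub_rpow_eq_integral (G H : LpOn Ω p F) :
    ‖G - H‖ ^ p = ∫ x in Ω, ‖G x - H x‖ ^ p := by
  have hp0 : 0 < p := one_pos.trans Fact.out
  rw [LpOn.norm_rpow_eq_integral hp0]
  exact integral_congr_ae ((Lp.coeFn_sub G H).mono fun x hx => by simp only [hx, Pi.sub_apply])

theorem LpOn.integrable_norm_sub_rpow (G H : LpOn Ω p F) :
    Integrable (fun x => ‖G x - H x‖ ^ p) (volume.restrict Ω) := by
  have hp0 : 0 < p := one_pos.trans Fact.out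
  exact (integrable_norm_rpow hp0 (G - H)).congr
    ((Lp.coeFn_sub G H).mono fun x hx => by simp only [hx, Pi.sub_apply])

/-- Minkowski's inequality for the scalar functions `|G|` and `|H|`. -/
theorem LpOn.integral_add_norm_rpow_le (G H : LpOn Ω p F) :
    Integrable (fun x => (‖G x‖ + ‖H x‖) ^ p) (volume.restrict Ω) ∧
      ∫ x in Ω, (‖G x‖ + ‖H x‖) ^ p ≤ (‖G‖ + ‖H‖) ^ p := by
  have hp0 : 0 < p := one_pos.trans Fact.out
  set A : LpOn Ω p ℝ := (Lp.memLp G).norm.toLp with hA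
  set B : LpOn Ω p ℝ := (Lp.memLp H).norm.toLp with hB
  have nA : ‖A‖ = ‖G‖ := by rw [hA, Lp.norm_toLp, eLpNorm_norm, Lp.norm_def]
  have nB : ‖B‖ = ‖H‖ := by rw [hB, Lp.norm_toLp, eLpNorm_norm, Lp.norm_def]
  have ae : (fun x => ‖(A + B : LpOn Ω p ℝ) x‖ ^ p) =ᵐ[volume.restrict Ω]
      fun x => (‖G x‖ + ‖H x‖) ^ p := by
    filter_upwards [Lp.coeFn_add A B, (Lp.memLp G).norm.coeFn_toLp,
      (Lp.memLp H).norm.coeFn_toLp] with x h1 h2 h3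
    rw [h1, Pi.add_apply, hA, hB, h2, h3, Real.norm_of_nonneg (by positivity)]
  refine ⟨(integrable_norm_rpow hp0 (A + B)).congr ae, ?_⟩
  rw [← integral_congr_ae ae, ← norm_rpow_eq_integral hp0, ← nA, ← nB]
  gcongr
  exact norm_add_le A B

variable [InnerProductSpace ℝ F]

theorem LpOn.norm_midpoint_rpow_eq_integral (G H : LpOn Ω p F) :
    ‖(1 / 2 : ℝ) • (G + H)‖ ^ p = ∫ x in Ω, ‖(1 / 2 : ℝ) • (G x + H x)‖ ^ p := by
  have hp0 : 0 < p := one_pos.trans Fact.out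
  rw [LpOn.norm_rpow_eq_integral hp0]
  exact integral_congr_ae ((coeFn_midpoint G H).mono fun x hx => by simp only [hx])

theorem LpOn.integrable_norm_midpoint_rpow (G H : LpOn Ω p F) :
    Integrable (fun x => ‖(1 / 2 : ℝ) • (G x + H x)‖ ^ p) (volume.restrict Ω) := by
  have hp0 : 0 < p := one_pos.trans Fact.out
  exact (integrable_norm_rpow hp0 ((1 / 2 : ℝ) • (G + H))).congr
    ((coeFn_midpoint G H).mono fun x hx => by simp only [hx])

theorem LpOn.integral_gap (G H : LpOn Ω p F) :
    ∫ x in Ω, ((‖G x‖ ^ p + ‖H x‖ ^ p) / 2 - ‖(1 / 2 : ℝ) • (G x + H x)‖ ^ p) =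
      (‖G‖ ^ p + ‖H‖ ^ p) / 2 - ‖(1 / 2 : ℝ) • (G + H)‖ ^ p := by
  have hp0 : 0 < p := one_pos.trans Fact.out
  have hG := integrable_norm_rpow hp0 G
  have hH := integrable_norm_rpow hp0 H
  have hGH : Integrable (fun x => ‖G x‖ ^ p + ‖H x‖ ^ p) (volume.restrict Ω) := hG.add hH
  rw [integral_sub (hGH.div_const 2) (integrable_norm_midpoint_rpow G H),
    integral_div, integral_add hG hH, norm_midpoint_rpow_eq_integral,
    LpOn.norm_rpow_eq_integral hp0 G, LpOn.norm_rpow_eq_integral hp0 H]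

theorem LpOn.integrable_gap (G H : LpOn Ω p F) :
    Integrable (fun x => (‖G x‖ ^ p + ‖H x‖ ^ p) / 2 - ‖(1 / 2 : ℝ) • (G x + H x)‖ ^ p)
      (volume.restrict Ω) := by
  have hp0 : 0 < p := one_pos.trans Fact.out
  exact (((integrable_norm_rpow hp0 G).add (integrable_norm_rpow hp0 H)).div_const 2).sub
    (integrable_norm_midpoint_rpow G H)

theorem rpow_gap_nonneg (a b : F) :
    0 ≤ (‖a‖ ^ p + ‖b‖ ^ p) / 2 - ‖(1 / 2 : ℝ) • (a + b)‖ ^ p := by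
  have hp1 : 1 < p := Fact.out
  have h1 : ‖(1 / 2 : ℝ) • (a + b)‖ ^ p ≤ ((‖a‖ + ‖b‖) / 2) ^ p := by
    gcongr
    exact norm_half_smul_add_le a b
  have h2 := (convexOn_rpow hp1.le).2 (Set.mem_Ici.2 (norm_nonneg a))
    (Set.mem_Ici.2 (norm_nonneg b)) (by norm_num : (0 : ℝ) ≤ 1 / 2)
    (by norm_num : (0 : ℝ) ≤ 1 / 2) (by norm_num)
  simp only [smul_eq_mul] at h2
  rw [show 1 / 2 * ‖a‖ + 1 / 2 * ‖b‖ = (‖a‖ + ‖b‖) / 2 by ring] at h2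
  linarith

theorem LpOn.gap_nonneg (G H : LpOn Ω p F) :
    0 ≤ (‖G‖ ^ p + ‖H‖ ^ p) / 2 - ‖(1 / 2 : ℝ) • (G + H)‖ ^ p := by
  rw [← integral_gap]
  exact integral_nonneg fun x => rpow_gap_nonneg _ _

theorem LpOn.norm_sub_rpow_le_gap (hp : 2 ≤ p) (G H : LpOn Ω p F) :
    ‖G - H‖ ^ p ≤ 2 ^ p * ((‖G‖ ^ p + ‖H‖ ^ p) / 2 - ‖(1 / 2 : ℝ) • (G + H)‖ ^ p) := by
  rw [norm_sub_rpow_eq_integral, ← integral_gap, ← integral_const_mul]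
  refine integral_mono (integrable_norm_sub_rpow G H) ((integrable_gap G H).const_mul _)
    fun x => ?_
  have := rpow_norm_midpoint_add_le hp (G x) (H x)
  have h2 : (2 : ℝ) ^ p * (1 / 2 : ℝ) ^ p = 1 := by
    rw [← Real.mul_rpow (by norm_num) (by norm_num)]; norm_num
  calc ‖G x - H x‖ ^ p = 2 ^ p * ((1 / 2 : ℝ) ^ p * ‖G x - H x‖ ^ p) := by
        rw [← mul_assoc, h2, one_mul]
    _ ≤ _ := by
        gcongr
        linarith

/-- The pointwise quadratic bound is raised to the power `p / 2` and integrated with Hölder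
exponents `2 / p` and `2 / (2 - p)`. The weight becomes `∫ (|G| + |H|) ^ p`, which Minkowski's
inequality bounds; a `2 / p`-th power restores the quadratic form. -/
theorem LpOn.sq_norm_sub_le_gap (hp2 : p < 2) (G H : LpOn Ω p F) :
    ‖G - H‖ ^ 2 ≤ 8 / (p * (p - 1)) *
      ((‖G‖ ^ p + ‖H‖ ^ p) / 2 - ‖(1 / 2 : ℝ) • (G + H)‖ ^ p) * (‖G‖ + ‖H‖) ^ (2 - p) := by
  have hp1 : 1 < p := Fact.out
  have hp0 : 0 < p := one_pos.trans hp1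
  have hK : 0 ≤ 8 / (p * (p - 1)) :=
    div_nonneg (by norm_num) (mul_nonneg hp0.le (by linarith))
  set K := 8 / (p * (p - 1))
  have sq_rpow {t : ℝ} (ht : 0 ≤ t) : (t ^ 2) ^ (p / 2) = t ^ p := by
    rw [← Real.rpow_natCast, ← Real.rpow_mul ht]; congr 1; push_cast; ring
  have two_sub {s : ℝ} (hs : 0 ≤ s) : (s ^ (2 - p)) ^ (p / 2) = (s ^ p) ^ (1 - p / 2) := by
    rw [← Real.rpow_mul hs, ← Real.rpow_mul hs]; congr 1; ring
  have hU0 (x) : 0 ≤ K * ((‖G x‖ ^ p + ‖H x‖ ^ p) / 2 - ‖(1 / 2 : ℝ) • (G x + H x)‖ ^ p) :=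
    mul_nonneg hK (rpow_gap_nonneg _ _)
  have hU := (integrable_gap G H).const_mul K
  obtain ⟨hV, hVle⟩ := integral_add_norm_rpow_le G H
  have hV0 (x) : 0 ≤ (‖G x‖ + ‖H x‖) ^ p := by positivity
  have holder := integral_rpow_mul_rpow_le (by linarith : 0 < p / 2) (by linarith : p / 2 < 1)
    hU hV hU0 hV0
  have hpt (x) : ‖G x - H x‖ ^ p ≤
      (K * ((‖G x‖ ^ p + ‖H x‖ ^ p) / 2 - ‖(1 / 2 : ℝ) • (G x + H x)‖ ^ p)) ^ (p / 2) *
        ((‖G x‖ + ‖H x‖) ^ p) ^ (1 - p / 2) := by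
    rw [← two_sub (by positivity), ← Real.mul_rpow (hU0 x) (by positivity),
      ← sq_rpow (norm_nonneg _)]
    gcongr
    exact sq_norm_sub_le_rpow_gap hp1 hp2 _ _
  have hgap := mul_nonneg hK (gap_nonneg G H)
  have main : ‖G - H‖ ^ p ≤
      (K * ((‖G‖ ^ p + ‖H‖ ^ p) / 2 - ‖(1 / 2 : ℝ) • (G + H)‖ ^ p)) ^ (p / 2) *
        ((‖G‖ + ‖H‖) ^ p) ^ (1 - p / 2) := by
    rw [norm_sub_rpow_eq_integral]
    refine (integral_mono_of_nonneg (ae_of_all _ fun x => by positivity) ?_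
      (ae_of_all _ hpt)).trans (holder.trans ?_)
    · have hθ : (p / 2)⁻¹.HolderConjugate (1 - p / 2)⁻¹ :=
        Real.holderConjugate_iff.2 ⟨(one_lt_inv₀ (by linarith)).2 (by linarith), by simp⟩
      have := hθ.ennrealOfReal
      exact MemLp.integrable_mul (memLp_rpow_of_integrable (by linarith) hU hU0)
        (memLp_rpow_of_integrable (by linarith) hV hV0)
    · rw [integral_const_mul, integral_gap]
      have : 0 ≤ 1 - p / 2 := by linarith
      gcongr
  rw [← two_sub (by positivity), ← Real.mul_rpow hgap (by positivity),
    ← sq_rpow (norm_nonneg _)] at main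
  exact (Real.rpow_le_rpow_iff (by positivity) (by positivity) (by linarith)).1 main

end LpConvexity

/-! ### The linear term and the friction densities -/

theorem LpOn.exists_pairing {N : ℕ} {Ω : Set (EuclideanSpace ℝ (Fin N))} {p : ℝ}
    [hp : Fact (1 < p)] {f : EuclideanSpace ℝ (Fin N) → ℝ}
    (hf : MemLp f (ENNReal.ofReal (p / (p - 1))) (volume.restrict Ω)) :
    ∃ P : LpOn Ω p ℝ →L[ℝ] ℝ, ∀ v, P v = ∫ x in Ω, f x * v x := by
  have hconj : (p / (p - 1)).HolderConjugate p :=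
    (Real.HolderConjugate.conjExponent hp.out).symm
  have : ENNReal.HolderConjugate (ENNReal.ofReal (p / (p - 1))) (ENNReal.ofReal p) :=
    hconj.ennrealOfReal
  have : Fact (1 ≤ ENNReal.ofReal (p / (p - 1))) :=
    ⟨by simpa using ENNReal.ofReal_le_ofReal hconj.lt.le⟩
  refine ⟨(ContinuousLinearMap.mul ℝ ℝ).lpPairing (volume.restrict Ω)
    (ENNReal.ofReal (p / (p - 1))) (ENNReal.ofReal p) (hf.toLp f), fun v => ?_⟩
  rw [ContinuousLinearMap.lpPairing_eq_integral]
  refine integral_congr_ae ?_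
  filter_upwards [hf.coeFn_toLp] with x hx
  rw [hx, ContinuousLinearMap.mul_apply']

/-- A nonnegative midpoint-convex `g`-Lipschitz density vanishing at the origin. -/
structure IsFrictionDensity {N : ℕ} (g : ℝ) (Φ : EuclideanSpace ℝ (Fin N) → ℝ) : Prop where
  map_zero : Φ 0 = 0
  nonneg : ∀ z, 0 ≤ Φ z
  midpoint_le : ∀ a b, Φ ((1 / 2 : ℝ) • (a + b)) ≤ (Φ a + Φ b) / 2
  lipschitz : LipschitzWith g.toNNReal Φ

theorem isFrictionDensity_norm {N : ℕ} {g : ℝ} (hg : 0 < g) :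
    IsFrictionDensity g fun z : EuclideanSpace ℝ (Fin N) => g * ‖z‖ where
  map_zero := by simp
  nonneg z := by positivity
  midpoint_le a b := by
    have := mul_le_mul_of_nonneg_left (norm_half_smul_add_le a b) hg.le
    linarith
  lipschitz := by
    refine LipschitzWith.of_le_add_mul _ fun a b => ?_
    rw [Real.coe_toNNReal g hg.le, dist_eq_norm, ← mul_add]
    gcongr
    have := norm_add_le b (a - b)
    rwa [add_sub_cancel] at this

/-- One half of the duality `ψ_γ(z) = max {s|z| - s² / (2γ) : 0 ≤ s ≤ g}`, from which the properties
of `ψ_γ` follow without further case distinctions. In the quadratic branch the difference is `(γ|z|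
- s)² / (2γ)`. -/
theorem le_huber {N : ℕ} {g γ s : ℝ} (hγ : 0 < γ) (hs : s ≤ g) (z : EuclideanSpace ℝ (Fin N)) :
    s * ‖z‖ - s ^ 2 / (2 * γ) ≤ huber g γ z := by
  have e {t : ℝ} : t ^ 2 / (2 * γ) * (2 * γ) = t ^ 2 := div_mul_cancel₀ _ (by positivity)
  refine le_of_mul_le_mul_right ?_ (by positivity : 0 < 2 * γ)
  rw [huber]
  split_ifs with h
  · rw [sub_mul, sub_mul, e, e]
    nlinarith [mul_nonneg (sub_nonneg.2 hs) (sub_nonneg.2 h)]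
  · rw [sub_mul, e]
    nlinarith [sq_nonneg (γ * ‖z‖ - s)]

/-- The other half: the maximum is attained at `s = min g (γ|z|)`. -/
theorem exists_huber_eq {N : ℕ} {g γ : ℝ} (hg : 0 ≤ g) (hγ : 0 < γ)
    (z : EuclideanSpace ℝ (Fin N)) :
    ∃ s, 0 ≤ s ∧ s ≤ g ∧ huber g γ z = s * ‖z‖ - s ^ 2 / (2 * γ) := by
  rw [huber]
  split_ifs with h
  · exact ⟨g, hg, le_rfl, rfl⟩
  · refine ⟨γ * ‖z‖, by positivity, (not_le.1 h).le, ?_⟩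
    field_simp
    ring

theorem huber_le {N : ℕ} {g γ : ℝ} (hg : 0 ≤ g) (hγ : 0 < γ) (z : EuclideanSpace ℝ (Fin N)) :
    huber g γ z ≤ g * ‖z‖ := by
  obtain ⟨s, hs0, hsg, hs⟩ := exists_huber_eq hg hγ z
  rw [hs]
  have : 0 ≤ s ^ 2 / (2 * γ) := by positivity
  have := mul_le_mul_of_nonneg_right hsg (norm_nonneg z)
  linarith

/-- For midpoint convexity and the Lipschitz bound, the slope `s` optimal at one point is kept at
the others, where it still gives a lower bound; the terms `s² / (2γ)` cancel and the triangle
inequality remains. -/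
theorem isFrictionDensity_huber {N : ℕ} {g γ : ℝ} (hg : 0 < g) (hγ : 0 < γ) :
    IsFrictionDensity g (huber (N := N) g γ) where
  map_zero := by simp [huber, hg.not_ge]
  nonneg z := by simpa using le_huber hγ hg.le z
  midpoint_le a b := by
    obtain ⟨s, hs0, hsg, hs⟩ := exists_huber_eq hg.le hγ ((1 / 2 : ℝ) • (a + b))
    have h1 := mul_le_mul_of_nonneg_left (norm_half_smul_add_le a b) hs0
    have h2 := le_huber hγ hsg a
    have h3 := le_huber hγ hsg b
    rw [hs]
    linarith
  lipschitz := by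
    refine LipschitzWith.of_le_add_mul _ fun a b => ?_
    obtain ⟨s, hs0, hsg, hs⟩ := exists_huber_eq hg.le hγ a
    rw [Real.coe_toNNReal g hg.le, dist_eq_norm, hs]
    have h1 := le_huber hγ hsg b
    have h2 := norm_add_le b (a - b)
    rw [add_sub_cancel] at h2
    have h3 := mul_le_mul_of_nonneg_left h2 hs0
    have h4 := mul_le_mul_of_nonneg_right hsg (norm_nonneg (a - b))
    linarith

/-- `(1/p) ∫_Ω |∇u|^p + ∫_Ω Φ(∇u) - ∫_Ω f u`. -/
noncomputable def frictionEnergy {N : ℕ} {Ω : Set (EuclideanSpace ℝ (Fin N))} {p : ℝ}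
    [Fact (1 < p)] (Φ : EuclideanSpace ℝ (Fin N) → ℝ) (f : EuclideanSpace ℝ (Fin N) → ℝ)
    (u : W01p Ω p) : ℝ :=
  1 / p * (∫ x in Ω, ‖W01p.grad u x‖ ^ p) + (∫ x in Ω, Φ (W01p.grad u x)) -
    ∫ x in Ω, f x * W01p.fn u x

/-! ### Energies: continuity, convexity gap and coercivity -/

theorem exists_bound_of_rpow_sub_le {p : ℝ} (hp1 : 1 < p) {L : ℝ} (hL : 0 ≤ L) (M : ℝ) :
    ∃ B, 0 ≤ B ∧ ∀ t, 0 ≤ t → 1 / p * t ^ p - L * t ≤ M → t ≤ B := by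
  have hp0 : 0 < p := one_pos.trans hp1
  have hq : 0 < p - 1 := sub_pos.2 hp1
  -- Beyond `B` one has `t ^ (p - 1) ≥ p (L + |M| + 1)`, hence `t ^ p / p ≥ (L + |M| + 1) t`; the
  -- `1` in the maximum gives `(|M| + 1) t ≥ |M| + 1 > M`.
  set B := max 1 ((p * (L + |M| + 1)) ^ (1 / (p - 1))) with hB
  have hB1 : 1 ≤ B := le_max_left _ _
  refine ⟨B, by linarith, fun t ht h => le_of_not_gt fun hlt => ?_⟩
  have ht0 : 0 < t := by linarith
  have h1 : p * (L + |M| + 1) ≤ t ^ (p - 1) := by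
    have : p * (L + |M| + 1) = ((p * (L + |M| + 1)) ^ (1 / (p - 1))) ^ (p - 1) := by
      rw [← Real.rpow_mul (by positivity), one_div_mul_cancel hq.ne', Real.rpow_one]
    rw [this]
    gcongr
    exact (le_max_right _ _).trans hlt.le
  have e : t ^ p = t ^ (p - 1) * t := by
    rw [← Real.rpow_add_one ht0.ne', sub_add_cancel]
  have h2 : (L + |M| + 1) * t ≤ 1 / p * t ^ p := by
    rw [e]
    calc (L + |M| + 1) * t = 1 / p * (p * (L + |M| + 1) * t) := by field_simp
      _ ≤ _ := by gcongr
  have h3 : |M| + 1 ≤ (|M| + 1) * t := le_mul_of_one_le_right (by positivity) (by linarith)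
  linarith [le_abs_self M]

section Energy

variable {N : ℕ} {Ω : Set (EuclideanSpace ℝ (Fin N))} {p : ℝ} [hp : Fact (1 < p)]
  {g : ℝ} {f Φ : EuclideanSpace ℝ (Fin N) → ℝ}

theorem energyJ_eq_frictionEnergy :
    energyJ (Ω := Ω) (p := p) g f = frictionEnergy (fun z => g * ‖z‖) f := by
  ext u
  rw [energyJ, frictionEnergy, integral_const_mul]

theorem energyJγ_eq_frictionEnergy (γ : ℝ) :
    energyJγ (Ω := Ω) (p := p) g f γ = frictionEnergy (huber g γ) f := rfl

theorem IsFrictionDensity.integrable_comp [IsFiniteMeasure (volume.restrict Ω)]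
    (hΦ : IsFrictionDensity g Φ) (G : LpOn Ω p (EuclideanSpace ℝ (Fin N))) :
    Integrable (fun x => Φ (G x)) (volume.restrict Ω) :=
  (hΦ.lipschitz.comp_memLp hΦ.map_zero (Lp.memLp G)).integrable Fact.out

/-- Composition with a Lipschitz map fixing zero is continuous on `L^p`, and on a finite measure
space the integral is the pairing with the constant `1`. -/
theorem IsFrictionDensity.continuous_integral [IsFiniteMeasure (volume.restrict Ω)]
    (hΦ : IsFrictionDensity g Φ) :
    Continuous fun G : LpOn Ω p (EuclideanSpace ℝ (Fin N)) => ∫ x in Ω, Φ (G x) := by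
  obtain ⟨P, hP⟩ := LpOn.exists_pairing (Ω := Ω) (p := p) (f := fun _ => 1) (memLp_const 1)
  have h := P.continuous.comp
    (hΦ.lipschitz.continuous_compLp (p := ENNReal.ofReal p) (μ := volume.restrict Ω) hΦ.map_zero)
  refine h.congr fun G => ?_
  rw [Function.comp_apply, hP]
  refine integral_congr_ae ?_
  filter_upwards [hΦ.lipschitz.coeFn_compLp hΦ.map_zero G] with x hx
  rw [hx, one_mul, Function.comp_apply]

theorem frictionEnergy_eq (u : W01p Ω p) :
    frictionEnergy Φ f u = 1 / p * W01p.gradNorm u ^ p + (∫ x in Ω, Φ (W01p.grad u x)) -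
      ∫ x in Ω, f x * W01p.fn u x := by
  rw [frictionEnergy, W01p.gradNorm, LpOn.norm_rpow_eq_integral (one_pos.trans hp.out)]

theorem W01p.continuous_fn : Continuous (W01p.fn : W01p Ω p → _) :=
  continuous_fst.comp continuous_subtype_val

theorem W01p.continuous_grad : Continuous (W01p.grad : W01p Ω p → _) :=
  continuous_snd.comp continuous_subtype_val

theorem continuous_frictionEnergy [IsFiniteMeasure (volume.restrict Ω)]
    (hΦ : IsFrictionDensity g Φ)
    (hf : MemLp f (ENNReal.ofReal (p / (p - 1))) (volume.restrict Ω)) :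
    Continuous (frictionEnergy (Ω := Ω) (p := p) Φ f) := by
  obtain ⟨P, hP⟩ := LpOn.exists_pairing hf
  have h1 : Continuous fun u : W01p Ω p => W01p.gradNorm u ^ p :=
    W01p.continuous_grad.norm.rpow_const fun _ => Or.inr (one_pos.trans hp.out).le
  have h2 := (hΦ.continuous_integral (Ω := Ω) (p := p)).comp W01p.continuous_grad
  have h3 := P.continuous.comp (W01p.continuous_fn (Ω := Ω) (p := p))
  refine (((h1.const_mul (1 / p)).add h2).sub h3).congr fun u => ?_
  rw [frictionEnergy_eq, ← hP]
  rfl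

/-- The Jensen gap of an energy at the midpoint of two functions. -/
noncomputable def midpointGap (E : W01p Ω p → ℝ) (u v : W01p Ω p) : ℝ :=
  (E u + E v) / 2 - E ((1 / 2 : ℝ) • (u + v))

/-- The linear term has zero gap and the friction term a nonnegative one; the factor `p` undoes the
`1 / p` of the energy. -/
theorem norm_gap_le_midpointGap [IsFiniteMeasure (volume.restrict Ω)]
    (hΦ : IsFrictionDensity g Φ)
    (hf : MemLp f (ENNReal.ofReal (p / (p - 1))) (volume.restrict Ω)) (u v : W01p Ω p) :
    (‖W01p.grad u‖ ^ p + ‖W01p.grad v‖ ^ p) / 2 -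
      ‖(1 / 2 : ℝ) • (W01p.grad u + W01p.grad v)‖ ^ p ≤
        p * midpointGap (frictionEnergy Φ f) u v := by
  have hp0 : 0 < p := one_pos.trans hp.out
  obtain ⟨P, hP⟩ := LpOn.exists_pairing hf
  have hgrad : W01p.grad ((1 / 2 : ℝ) • (u + v)) =
    (1 / 2 : ℝ) • (W01p.grad u + W01p.grad v) := rfl
  have hfn : W01p.fn ((1 / 2 : ℝ) • (u + v)) = (1 / 2 : ℝ) • (W01p.fn u + W01p.fn v) := rfl
  have hΦle : ∫ x in Ω, Φ (W01p.grad ((1 / 2 : ℝ) • (u + v)) x) ≤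
      ((∫ x in Ω, Φ (W01p.grad u x)) + ∫ x in Ω, Φ (W01p.grad v x)) / 2 := by
    have hu := hΦ.integrable_comp (W01p.grad u)
    have hv := hΦ.integrable_comp (W01p.grad v)
    rw [← integral_add hu hv, ← integral_div]
    refine integral_mono_ae (hΦ.integrable_comp _) ((hu.add hv).div_const 2) ?_
    filter_upwards [LpOn.coeFn_midpoint (W01p.grad u) (W01p.grad v)] with x hx
    rw [hgrad, hx]
    exact hΦ.midpoint_le _ _
  rw [midpointGap, frictionEnergy_eq, frictionEnergy_eq, frictionEnergy_eq, ← hP, ← hP, ← hP,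
    hfn, map_smul, map_add, smul_eq_mul]
  simp only [W01p.gradNorm]
  rw [hgrad] at *
  have e (t : ℝ) : t = p * (1 / p * t) := by field_simp
  rw [e ((‖W01p.grad u‖ ^ p + ‖W01p.grad v‖ ^ p) / 2 - _)]
  gcongr
  linarith

theorem gradNorm_sub_rpow_le_midpointGap [IsFiniteMeasure (volume.restrict Ω)]
    (hΦ : IsFrictionDensity g Φ)
    (hf : MemLp f (ENNReal.ofReal (p / (p - 1))) (volume.restrict Ω)) (hp2 : 2 ≤ p)
    (u v : W01p Ω p) :
    W01p.gradNorm (u - v) ^ p ≤ p * 2 ^ p * midpointGap (frictionEnergy Φ f) u v := by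
  have h1 := LpOn.norm_sub_rpow_le_gap hp2 (W01p.grad u) (W01p.grad v)
  have h2 := mul_le_mul_of_nonneg_left (norm_gap_le_midpointGap hΦ hf u v)
    (by positivity : (0 : ℝ) ≤ 2 ^ p)
  have e : W01p.gradNorm (u - v) = ‖W01p.grad u - W01p.grad v‖ := rfl
  rw [e]
  linarith

theorem midpointGap_nonneg [IsFiniteMeasure (volume.restrict Ω)]
    (hΦ : IsFrictionDensity g Φ)
    (hf : MemLp f (ENNReal.ofReal (p / (p - 1))) (volume.restrict Ω)) (u v : W01p Ω p) :
    0 ≤ midpointGap (frictionEnergy Φ f) u v :=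
  nonneg_of_mul_nonneg_right
    ((LpOn.gap_nonneg _ _).trans (norm_gap_le_midpointGap hΦ hf u v)) (one_pos.trans hp.out)

theorem sq_gradNorm_sub_le_midpointGap [IsFiniteMeasure (volume.restrict Ω)]
    (hΦ : IsFrictionDensity g Φ)
    (hf : MemLp f (ENNReal.ofReal (p / (p - 1))) (volume.restrict Ω)) (hp2 : p < 2)
    (u v : W01p Ω p) :
    W01p.gradNorm (u - v) ^ 2 ≤ 8 / (p - 1) * midpointGap (frictionEnergy Φ f) u v *
      (W01p.gradNorm u + W01p.gradNorm v) ^ (2 - p) := by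
  have hp0 : 0 < p := one_pos.trans hp.out
  have hp1 : 0 < p - 1 := sub_pos.2 hp.out
  refine (LpOn.sq_norm_sub_le_gap hp2 (W01p.grad u) (W01p.grad v)).trans ?_
  simp only [W01p.gradNorm]
  have e : 8 / (p - 1) * midpointGap (frictionEnergy Φ f) u v =
      8 / (p * (p - 1)) * (p * midpointGap (frictionEnergy Φ f) u v) := by
    field_simp
  rw [e]
  gcongr
  exact norm_gap_le_midpointGap hΦ hf u v

/-- A common form of the two regimes, with `r = p` or `r = 2`. On a gradient ball the weight of the
case `p < 2` is bounded, which suffices for existence and uniqueness. -/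
theorem exists_gradNorm_sub_rpow_le [IsFiniteMeasure (volume.restrict Ω)]
    (hf : MemLp f (ENNReal.ofReal (p / (p - 1))) (volume.restrict Ω)) (B : ℝ) :
    ∃ r K : ℝ, 0 < r ∧ 0 < K ∧ ∀ (Φ : EuclideanSpace ℝ (Fin N) → ℝ), IsFrictionDensity g Φ →
      ∀ u v : W01p Ω p, W01p.gradNorm u ≤ B → W01p.gradNorm v ≤ B →
        W01p.gradNorm (u - v) ^ r ≤ K * midpointGap (frictionEnergy Φ f) u v := by
  have hp0 : 0 < p := one_pos.trans hp.out
  have hp1 : 0 < p - 1 := sub_pos.2 hp.out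
  rcases le_or_gt 2 p with h2 | h2
  · exact ⟨p, p * 2 ^ p, hp0, by positivity,
      fun Φ hΦ u v _ _ => gradNorm_sub_rpow_le_midpointGap hΦ hf h2 u v⟩
  · have hB : 0 < 2 * max B 1 := by positivity
    refine ⟨2, 8 / (p - 1) * (2 * max B 1) ^ (2 - p), by norm_num, by positivity,
      fun Φ hΦ u v hu hv => ?_⟩
    rw [Real.rpow_two]
    refine (sq_gradNorm_sub_le_midpointGap hΦ hf h2 u v).trans ?_
    have hs : W01p.gradNorm u + W01p.gradNorm v ≤ 2 * max B 1 := by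
      linarith [le_max_left B 1]
    have hs0 : 0 ≤ W01p.gradNorm u + W01p.gradNorm v := add_nonneg (norm_nonneg _) (norm_nonneg _)
    have := midpointGap_nonneg hΦ hf u v
    rw [mul_right_comm]
    gcongr

/-- Coercivity, uniformly in the friction density. -/
theorem exists_le_frictionEnergy (hN : 1 ≤ N) (hΩ : Bornology.IsBounded Ω)
    (hf : MemLp f (ENNReal.ofReal (p / (p - 1))) (volume.restrict Ω)) :
    ∃ L, 0 ≤ L ∧ ∀ (Φ : EuclideanSpace ℝ (Fin N) → ℝ), (∀ z, 0 ≤ Φ z) → ∀ u : W01p Ω p,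
      1 / p * W01p.gradNorm u ^ p - L * W01p.gradNorm u ≤ frictionEnergy Φ f u := by
  obtain ⟨P, hP⟩ := LpOn.exists_pairing hf
  obtain ⟨K, hK, hKu⟩ := W01p.exists_norm_fn_le hN hΩ p
  refine ⟨‖P‖ * K, by positivity, fun Φ hΦ u => ?_⟩
  rw [frictionEnergy_eq, ← hP]
  have h1 : 0 ≤ ∫ x in Ω, Φ (W01p.grad u x) := integral_nonneg fun x => hΦ _
  have h2 : P (W01p.fn u) ≤ ‖P‖ * K * W01p.gradNorm u := by
    rw [mul_assoc]
    exact (le_abs_self _).trans ((P.le_opNorm _).trans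
      (mul_le_mul_of_nonneg_left (hKu u) (norm_nonneg P)))
  linarith

/-! ### Existence and uniqueness of minimizers -/

theorem W01p.exists_dist_le (hN : 1 ≤ N) (hΩ : Bornology.IsBounded Ω) :
    ∃ K, 0 < K ∧ ∀ u v : W01p Ω p, dist u v ≤ K * W01p.gradNorm (u - v) := by
  obtain ⟨K, hK, hKu⟩ := W01p.exists_norm_fn_le hN hΩ p
  refine ⟨K + 1, by positivity, fun u v => ?_⟩
  have h0 : 0 ≤ W01p.gradNorm (u - v) := norm_nonneg _
  rw [dist_eq_norm, Submodule.coe_norm, Prod.norm_def]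
  refine max_le ((hKu (u - v)).trans ?_) ?_
  · linarith
  · change W01p.gradNorm (u - v) ≤ _
    linarith [mul_nonneg hK h0]

instance W01p.instCompleteSpace : CompleteSpace (W01p Ω p) :=
  (testGraph Ω p).isClosed_topologicalClosure.completeSpace_coe

/-- Coercivity confines near-minimizers to a gradient ball. If two energies are within `δ` of the
infimum, the gap is at most `δ`, because the midpoint energy is no less than the infimum; hence the
two points are close. -/
theorem existsUnique_isMinimizer_frictionEnergy [IsFiniteMeasure (volume.restrict Ω)]
    (hN : 1 ≤ N) (hΩ : Bornology.IsBounded Ω) (hΦ : IsFrictionDensity g Φ)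
    (hf : MemLp f (ENNReal.ofReal (p / (p - 1))) (volume.restrict Ω)) :
    ∃! u : W01p Ω p, IsMinimizer (frictionEnergy Φ f) u := by
  obtain ⟨L, hL, hcoer⟩ := exists_le_frictionEnergy hN hΩ hf
  obtain ⟨C, hC, hdist⟩ := W01p.exists_dist_le (p := p) hN hΩ
  have hbdd : BddBelow (Set.range (frictionEnergy (Ω := Ω) (p := p) Φ f)) := by
    obtain ⟨B, hB, hB'⟩ := exists_bound_of_rpow_sub_le hp.out hL 0
    refine ⟨-(L * B), ?_⟩
    rintro _ ⟨u, rfl⟩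
    refine le_trans ?_ (hcoer Φ hΦ.nonneg u)
    have h0 : 0 ≤ W01p.gradNorm u := norm_nonneg _
    rcases le_total (1 / p * W01p.gradNorm u ^ p - L * W01p.gradNorm u) 0 with h | h
    · have := mul_le_mul_of_nonneg_left (hB' _ h0 h) hL
      have : 0 ≤ 1 / p * W01p.gradNorm u ^ p :=
        mul_nonneg (one_div_nonneg.2 (one_pos.trans hp.out).le) (Real.rpow_nonneg h0 p)
      linarith
    · exact (neg_nonpos.2 (mul_nonneg hL hB)).trans h
  refine existsUnique_of_exists_of_unique ?_ ?_
  · refine exists_isMinimizer_of_close (continuous_frictionEnergy hΦ hf) hbdd fun ε hε => ?_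
    set m := sInf (Set.range (frictionEnergy (Ω := Ω) (p := p) Φ f)) with hm
    obtain ⟨B, hB, hB'⟩ := exists_bound_of_rpow_sub_le hp.out hL (m + 1)
    obtain ⟨r, K, hr, hK, hgap⟩ := exists_gradNorm_sub_rpow_le (g := g) hf B
    -- The `1` keeps the energies below `m + 1`, the level for which `B` was chosen; the other entry
    -- makes `K` times the gap at most `(ε / C) ^ r`.
    refine ⟨min 1 ((ε / C) ^ r / K), by positivity, fun u v hu hv => ?_⟩
    have hbound (w : W01p Ω p) (hw : frictionEnergy Φ f w ≤ m + min 1 ((ε / C) ^ r / K)) :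
        W01p.gradNorm w ≤ B :=
      hB' _ (norm_nonneg _) ((hcoer Φ hΦ.nonneg w).trans
        (hw.trans (by linarith [min_le_left 1 ((ε / C) ^ r / K)])))
    have h1 := hgap Φ hΦ u v (hbound u hu) (hbound v hv)
    have h2 : midpointGap (frictionEnergy Φ f) u v ≤ (ε / C) ^ r / K := by
      have : m ≤ frictionEnergy Φ f ((1 / 2 : ℝ) • (u + v)) := csInf_le hbdd ⟨_, rfl⟩
      rw [midpointGap]
      linarith [min_le_right 1 ((ε / C) ^ r / K)]
    have h3 : W01p.gradNorm (u - v) ^ r ≤ (ε / C) ^ r := by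
      refine h1.trans ?_
      rwa [le_div_iff₀' hK] at h2
    have h4 := (Real.rpow_le_rpow_iff (norm_nonneg _) (by positivity) hr).1 h3
    refine (hdist u v).trans ?_
    rwa [le_div_iff₀' hC] at h4
  · intro u v hu hv
    obtain ⟨r, K, hr, hK, hgap⟩ := exists_gradNorm_sub_rpow_le (Ω := Ω) (g := g) hf
      (max (W01p.gradNorm u) (W01p.gradNorm v))
    have h1 := hgap Φ hΦ u v (le_max_left _ _) (le_max_right _ _)
    have h2 : midpointGap (frictionEnergy Φ f) u v ≤ 0 := by
      rw [midpointGap]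
      linarith [hu ((1 / 2 : ℝ) • (u + v)), hv ((1 / 2 : ℝ) • (u + v))]
    have h3 : W01p.gradNorm (u - v) ^ r ≤ 0 := h1.trans (mul_nonpos_of_nonneg_of_nonpos hK.le h2)
    have h0 : 0 ≤ W01p.gradNorm (u - v) := norm_nonneg _
    have h4 : W01p.gradNorm (u - v) = 0 := by
      by_contra hne
      exact h3.not_gt (Real.rpow_pos_of_pos (h0.lt_of_ne' hne) r)
    refine dist_le_zero.1 ((hdist u v).trans ?_)
    rw [h4, mul_zero]

/-- Comparison with the zero function, whose energy is `0`. The coercivity constants do not depend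
on the density, so `B` is uniform in `γ`. -/
theorem exists_gradNorm_minimizer_le (hN : 1 ≤ N) (hΩ : Bornology.IsBounded Ω)
    (hf : MemLp f (ENNReal.ofReal (p / (p - 1))) (volume.restrict Ω)) :
    ∃ B, 0 ≤ B ∧ ∀ (Φ : EuclideanSpace ℝ (Fin N) → ℝ), IsFrictionDensity g Φ →
      ∀ u : W01p Ω p, IsMinimizer (frictionEnergy Φ f) u → W01p.gradNorm u ≤ B := by
  obtain ⟨L, hL, hcoer⟩ := exists_le_frictionEnergy hN hΩ hf
  obtain ⟨B, hB, hB'⟩ := exists_bound_of_rpow_sub_le hp.out hL 0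
  refine ⟨B, hB, fun Φ hΦ u hu => hB' _ (norm_nonneg _) ((hcoer Φ hΦ.nonneg u).trans ?_)⟩
  have h0 : frictionEnergy Φ f (0 : W01p Ω p) = 0 := by
    obtain ⟨P, hP⟩ := LpOn.exists_pairing hf
    have hgrad : W01p.grad (0 : W01p Ω p) = 0 := rfl
    have hfn : W01p.fn (0 : W01p Ω p) = 0 := rfl
    have hz : ∫ x in Ω, Φ ((0 : LpOn Ω p (EuclideanSpace ℝ (Fin N))) x) = 0 := by
      refine integral_eq_zero_of_ae ?_
      filter_upwards [Lp.coeFn_zero (EuclideanSpace ℝ (Fin N)) (ENNReal.ofReal p)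
        (volume.restrict Ω)] with x hx
      rw [hx, Pi.zero_apply, hΦ.map_zero, Pi.zero_apply]
    rw [frictionEnergy_eq, ← hP, hfn, W01p.gradNorm, hgrad, hz, map_zero, norm_zero,
      Real.zero_rpow (one_pos.trans hp.out).ne']
    ring
  exact h0 ▸ hu 0

/-! ### Comparison of the two energies and convergence rates -/

theorem frictionEnergy_norm_sub_huber [IsFiniteMeasure (volume.restrict Ω)] (hg : 0 < g)
    {γ : ℝ} (hγ : 0 < γ) (u : W01p Ω p) :
    frictionEnergy (huber g γ) f u ≤ frictionEnergy (fun z => g * ‖z‖) f u ∧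
      frictionEnergy (fun z => g * ‖z‖) f u ≤
        frictionEnergy (huber g γ) f u + g ^ 2 * volume.real Ω / (2 * γ) := by
  have hJ := (isFrictionDensity_norm hg).integrable_comp (W01p.grad u)
  have hH := (isFrictionDensity_huber hg hγ).integrable_comp (W01p.grad u)
  have h1 := integral_mono hH hJ fun x => huber_le hg.le hγ _
  have h2 : ∫ x in Ω, g * ‖W01p.grad u x‖ ≤
      ∫ x in Ω, (huber g γ (W01p.grad u x) + g ^ 2 / (2 * γ)) :=
    integral_mono hJ (hH.add (integrable_const _)) fun x => by
      have := le_huber hγ le_rfl (g := g) (W01p.grad u x)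
      dsimp only
      linarith
  rw [integral_add hH (integrable_const _), integral_const, measureReal_restrict_apply_univ,
    smul_eq_mul, mul_div_assoc', mul_comm (volume.real Ω)] at h2
  simp only [frictionEnergy]
  constructor <;> linarith

/-- Minimality replaces the midpoint energies by `J(v)` and `J_γ(u)`. What remains is half of `(J -
J_γ)(u) - (J - J_γ)(v)`, where `J - J_γ` lies between `0` and `g²|Ω| / (2γ)`. -/
theorem midpointGap_add_le [IsFiniteMeasure (volume.restrict Ω)] (hg : 0 < g) {γ : ℝ}
    (hγ : 0 < γ) {v u : W01p Ω p} (hv : IsMinimizer (frictionEnergy (fun z => g * ‖z‖) f) v)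
    (hu : IsMinimizer (frictionEnergy (huber g γ) f) u) :
    midpointGap (frictionEnergy (fun z => g * ‖z‖) f) v u +
      midpointGap (frictionEnergy (huber g γ) f) v u ≤ g ^ 2 * volume.real Ω / γ / 4 := by
  have h1 := hv ((1 / 2 : ℝ) • (v + u))
  have h2 := hu ((1 / 2 : ℝ) • (v + u))
  have h3 := (frictionEnergy_norm_sub_huber (f := f) hg hγ u).2
  have h4 := (frictionEnergy_norm_sub_huber (f := f) hg hγ v).1
  have e : g ^ 2 * volume.real Ω / (2 * γ) = g ^ 2 * volume.real Ω / γ / 2 := by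
    rw [div_div, mul_comm γ]
  rw [e] at h3
  simp only [midpointGap]
  linarith

theorem gradNorm_sub_le_of_two_le [IsFiniteMeasure (volume.restrict Ω)] (hg : 0 < g)
    (hf : MemLp f (ENNReal.ofReal (p / (p - 1))) (volume.restrict Ω)) (hp2 : 2 ≤ p) {γ : ℝ}
    (hγ : 0 < γ) {v u : W01p Ω p} (hv : IsMinimizer (frictionEnergy (fun z => g * ‖z‖) f) v)
    (hu : IsMinimizer (frictionEnergy (huber g γ) f) u) :
    W01p.gradNorm (v - u) ≤ (g ^ 2 * volume.real Ω / (8 / (p * 2 ^ p) * γ)) ^ (1 / p) := by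
  have hp0 : 0 < p := one_pos.trans hp.out
  have h0 : 0 ≤ W01p.gradNorm (v - u) := norm_nonneg _
  have h1 := gradNorm_sub_rpow_le_midpointGap (isFrictionDensity_norm hg) hf hp2 v u
  have h2 := gradNorm_sub_rpow_le_midpointGap (isFrictionDensity_huber hg hγ) hf hp2 v u
  have h3 := mul_le_mul_of_nonneg_left (midpointGap_add_le hg hγ hv hu)
    (by positivity : 0 ≤ p * 2 ^ p)
  have h4 : W01p.gradNorm (v - u) ^ p ≤ g ^ 2 * volume.real Ω / (8 / (p * 2 ^ p) * γ) := by
    -- Adding the bounds for both gaps counts the left side twice; the factors `1 / 4` and `1 / 2`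
    -- give the `8` in the constant.
    have e : g ^ 2 * volume.real Ω / (8 / (p * 2 ^ p) * γ) =
        p * 2 ^ p * (g ^ 2 * volume.real Ω / γ / 4) / 2 := by
      field_simp
      ring
    rw [e]
    linarith
  rw [one_div]
  exact (Real.le_rpow_inv_iff_of_pos h0 (by positivity) hp0).2 h4

theorem gradNorm_sub_le_of_lt_two [IsFiniteMeasure (volume.restrict Ω)] (hg : 0 < g)
    (hf : MemLp f (ENNReal.ofReal (p / (p - 1))) (volume.restrict Ω)) (hp2 : p < 2) {γ : ℝ}
    (hγ : 0 < γ) {v u : W01p Ω p} (hv : IsMinimizer (frictionEnergy (fun z => g * ‖z‖) f) v)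
    (hu : IsMinimizer (frictionEnergy (huber g γ) f) u) :
    W01p.gradNorm (v - u) ≤ (g ^ 2 * volume.real Ω / ((p - 1) * γ)) ^ (1 / 2 : ℝ) *
      (W01p.gradNorm v + W01p.gradNorm u) ^ ((2 - p) / 2) := by
  have hp1 : 0 < p - 1 := sub_pos.2 hp.out
  have h0 : 0 ≤ W01p.gradNorm (v - u) := norm_nonneg _
  have hS0 : 0 ≤ W01p.gradNorm v + W01p.gradNorm u := add_nonneg (norm_nonneg _) (norm_nonneg _)
  have h1 := sq_gradNorm_sub_le_midpointGap (isFrictionDensity_norm hg) hf hp2 v u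
  have h2 := sq_gradNorm_sub_le_midpointGap (isFrictionDensity_huber hg hγ) hf hp2 v u
  set S := W01p.gradNorm v + W01p.gradNorm u
  have h3 := mul_le_mul_of_nonneg_left (midpointGap_add_le hg hγ hv hu)
    (by positivity : 0 ≤ 8 / (p - 1) * S ^ (2 - p))
  have h4 : W01p.gradNorm (v - u) ^ 2 ≤
      g ^ 2 * volume.real Ω / ((p - 1) * γ) * S ^ (2 - p) := by
    -- Here the same factor `1 / 8` cancels the `8` of the quadratic gap inequality, leaving `p -
    -- 1`.
    have e : g ^ 2 * volume.real Ω / ((p - 1) * γ) * S ^ (2 - p) =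
        8 / (p - 1) * S ^ (2 - p) * (g ^ 2 * volume.real Ω / γ / 4) / 2 := by
      field_simp
      ring
    rw [e]
    linarith
  rw [show (2 - p) / 2 = (2 - p) * (1 / 2) by ring, Real.rpow_mul hS0,
    ← Real.mul_rpow (by positivity) (by positivity), ← Real.sqrt_eq_rpow]
  exact Real.le_sqrt_of_sq_le h4

end Energy

/-! ### Strong convergence and the main theorem -/

theorem tendsto_of_gradNorm_sub_le {N : ℕ} {Ω : Set (EuclideanSpace ℝ (Fin N))} {p : ℝ}
    [Fact (1 < p)] (hN : 1 ≤ N) (hΩ : Bornology.IsBounded Ω) {v : W01p Ω p} {u : ℝ → W01p Ω p}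
    {ρ : ℝ → ℝ} (hρ : Tendsto ρ atTop (𝓝 0))
    (h : ∀ γ, 0 < γ → W01p.gradNorm (v - u γ) ≤ ρ γ) : Tendsto u atTop (𝓝 v) := by
  obtain ⟨C, hC, hdist⟩ := W01p.exists_dist_le (p := p) hN hΩ
  rw [tendsto_iff_dist_tendsto_zero]
  refine squeeze_zero' (Eventually.of_forall fun γ => dist_nonneg) ?_
    (by simpa using hρ.const_mul C)
  filter_upwards [eventually_gt_atTop 0] with γ hγ
  rw [dist_comm]
  exact (hdist v (u γ)).trans (mul_le_mul_of_nonneg_left (h γ hγ) hC.le)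

theorem mainTheorem1 (p : ℝ) [Fact (1 < p)] :
    ∃ c : ℝ, 0 < c ∧
      ∀ (N : ℕ), 1 ≤ N →
      ∀ (Ω : Set (EuclideanSpace ℝ (Fin N))), IsOpen Ω → Bornology.IsBounded Ω →
      ∀ (g : ℝ), 0 < g →
      ∀ (f : EuclideanSpace ℝ (Fin N) → ℝ),
        MemLp f (ENNReal.ofReal (p / (p - 1))) (volume.restrict Ω) →
      -- the problem and each regularized problem have a unique solution
      (∃! ubar : W01p Ω p, IsMinimizer (energyJ g f) ubar) ∧
      (∀ γ : ℝ, 0 < γ → ∃! u : W01p Ω p, IsMinimizer (energyJγ g f γ) u) ∧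
      ∀ (ubar : W01p Ω p), IsMinimizer (energyJ g f) ubar →
      ∀ (u : ℝ → W01p Ω p), (∀ γ : ℝ, 0 < γ → IsMinimizer (energyJγ g f γ) (u γ)) →
        -- strong convergence
        Tendsto u atTop (𝓝 ubar) ∧
        -- rate for `p ≥ 2`
        (2 ≤ p → ∀ γ : ℝ, 0 < γ →
          W01p.gradNorm (ubar - u γ) ≤ (g ^ 2 * volume.real Ω / (c * γ)) ^ (1 / p)) ∧
        -- rate for `1 < p < 2`
        (p < 2 →
          (∀ γ : ℝ, 0 < γ →
            W01p.gradNorm (ubar - u γ) ≤ (g ^ 2 * volume.real Ω / (c * γ)) ^ (1 / 2 : ℝ) *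
              (W01p.gradNorm ubar + W01p.gradNorm (u γ)) ^ ((2 - p) / 2)) ∧
          ∃ C : ℝ, ∀ γ : ℝ, 0 < γ → W01p.gradNorm (ubar - u γ) ≤ C * γ ^ (-(1 / 2 : ℝ))) := by
  have hp : 1 < p := Fact.out
  have hp0 : 0 < p := one_pos.trans hp
  have hp1 : 0 < p - 1 := sub_pos.2 hp
  refine ⟨if 2 ≤ p then 8 / (p * 2 ^ p) else p - 1, by split_ifs <;> positivity, ?_⟩
  intro N hN Ω _ hΩ g hg f hf
  have : IsFiniteMeasure (volume.restrict Ω) := ⟨by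
    rw [Measure.restrict_apply_univ]; exact hΩ.measure_lt_top⟩
  simp only [energyJ_eq_frictionEnergy, energyJγ_eq_frictionEnergy]
  refine ⟨existsUnique_isMinimizer_frictionEnergy hN hΩ (isFrictionDensity_norm hg) hf,
    fun γ hγ => existsUnique_isMinimizer_frictionEnergy hN hΩ (isFrictionDensity_huber hg hγ) hf,
    fun v hv u hu => ?_⟩
  rcases le_or_gt 2 p with h2 | h2
  · rw [if_pos h2]
    have rate (γ : ℝ) (hγ : 0 < γ) := gradNorm_sub_le_of_two_le hg hf h2 hγ hv (hu γ hγ)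
    refine ⟨tendsto_of_gradNorm_sub_le hN hΩ ?_ rate, fun _ => rate, fun h => absurd h2 h.not_ge⟩
    have hlim : Tendsto (fun γ : ℝ => g ^ 2 * volume.real Ω / (8 / (p * 2 ^ p) * γ)) atTop (𝓝 0) :=
      tendsto_const_nhds.div_atTop (tendsto_id.const_mul_atTop (by positivity))
    simpa [Real.zero_rpow, hp0.ne'] using
      hlim.rpow_const (p := 1 / p) (Or.inr (by positivity))
  · rw [if_neg h2.not_ge]
    have rate (γ : ℝ) (hγ : 0 < γ) := gradNorm_sub_le_of_lt_two hg hf h2 hγ hv (hu γ hγ)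
    obtain ⟨B, hB, hbound⟩ := exists_gradNorm_minimizer_le (p := p) (g := g) hN hΩ hf
    -- The rate still contains `‖∇u_γ‖`; the bound `B`, uniform in `γ`, removes it and yields both
    -- `C` and the convergence.
    set C := (g ^ 2 * volume.real Ω / (p - 1)) ^ (1 / 2 : ℝ) * (2 * B) ^ ((2 - p) / 2) with hC
    have rate' (γ : ℝ) (hγ : 0 < γ) :
        W01p.gradNorm (v - u γ) ≤ C * γ ^ (-(1 / 2 : ℝ)) := by
      have hsum : W01p.gradNorm v + W01p.gradNorm (u γ) ≤ 2 * B := by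
        linarith [hbound _ (isFrictionDensity_norm hg) v hv,
          hbound _ (isFrictionDensity_huber hg hγ) (u γ) (hu γ hγ)]
      have hS0 : 0 ≤ W01p.gradNorm v + W01p.gradNorm (u γ) :=
        add_nonneg (norm_nonneg _) (norm_nonneg _)
      have hexp : 0 ≤ (2 - p) / 2 := by linarith
      calc W01p.gradNorm (v - u γ) ≤ (g ^ 2 * volume.real Ω / ((p - 1) * γ)) ^ (1 / 2 : ℝ) *
            (W01p.gradNorm v + W01p.gradNorm (u γ)) ^ ((2 - p) / 2) := rate γ hγ
        _ ≤ (g ^ 2 * volume.real Ω / ((p - 1) * γ)) ^ (1 / 2 : ℝ) * (2 * B) ^ ((2 - p) / 2) := by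
          gcongr
        _ = C * γ ^ (-(1 / 2 : ℝ)) := by
          rw [← div_div, Real.div_rpow (by positivity) hγ.le, Real.rpow_neg hγ.le, hC]
          ring
    refine ⟨tendsto_of_gradNorm_sub_le hN hΩ ?_ rate', fun h => absurd h h2.not_ge,
      fun _ => ⟨rate, C, rate'⟩⟩
    simpa using (tendsto_rpow_neg_atTop (by norm_num : (0 : ℝ) < 1 / 2)).const_mul C
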